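/- Let $J=\begin{pmatrix}0&1\\-1&0\end{pmatrix}$ and $Q=\begin{pmatrix}0&I_3\\I_3&0\end{pmatrix}$, let $SL_2=SL_2(\mathbb C)$ act on $\mathrm{Mat}_{2\times 6}(\mathbb C)$ by left multiplication, and let $\mu^{-1}(0)\subset \mathrm{Mat}_{2\times 6}$ be the scheme-theoretic zero fibre of the moment map $\mu(M)=MQM^tJ$. Let $SO_6=\{g\mid g^tQg=Q,\ \det g=1\}$, $\mathfrak{so}_6=\{A\mid A^tQ+QA=0\}$, and let $O_{[2^2,1^2]}$ be the nilpotent $SO_6$-orbit, under conjugation, of the matrix $A_0=(a_{ij})$ with $a_{15}=-a_{24}=1$ and all other entries $0$ (it has Jordan type $[2^2,1^2]$). Let $$\overline O_{[2^2,1^2]}=\{A\in\mathfrak{so}_6\mid A^2=0,\ \operatorname{rk}A\le 2,\ \operatorname{Pf}_4(QA)=0\}$$ be the closed subscheme of $\mathrm{Mat}_{6\times 6}$ defined by these equations, where $\operatorname{Pf}_4(QA)$ denotes the Pfaffians of the skew-symmetric $4\times 4$ submatrices of $QA$ and the rank condition means the vanishing of the $3\times3$ minors. Let $\nu\colon\mu^{-1}(0)\to\overline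 O_{[2^2,1^2]}$, $M\mapsto M^tJMQ$, be the morphism given by this formula (the quotient map of the $SL_2$-action). Then $\overline O_{[2^2,1^2]}$ has complex points $O_{[2^2,1^2]}\cup\{0\}$, and $O_{[2^2,1^2]}$ is the set of closed points of a dense open reduced subscheme of it. The restriction $\nu^{-1}(O_{[2^2,1^2]})\to O_{[2^2,1^2]}$ of $\nu$ is flat, and its scheme-theoretic fibres over all (complex) points of $O_{[2^2,1^2]}$ are isomorphic over $\mathbb C$ to each other. Every such fibre $F=\nu^{-1}(A)$ is $SL_2$-equivariantly isomorphic to $SL_2$ (with the action by left multiplication). Its Hilbert function is $h(d)=\dim\operatorname{Hom}_{SL_2}(V_d,\mathbb C[F])=d+1$ for all $d\ge 0$, where $V_d=\mathbb C[x,y]_d$ is the irreducible representation of $SL_2$ of dimension $d+1$. -/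

import Mathlib

open AlgebraicGeometry CategoryTheory
open scoped MatrixGroups

noncomputable section

namespace SymplecticReduction

/-- The index set of the six columns, written as `3 + 3`: `Sum.inl i` is the column `i`, and
`Sum.inr i` is the column `3 + i`. -/
abbrev Idx : Type := Fin 3 ⊕ Fin 3

/-- `J = (0, 1; -1, 0)`. -/
def formJ (R : Type*) [CommRing R] : Matrix (Fin 2) (Fin 2) R := !![0, 1; -1, 0]

/-- `Q = (0, I₃; I₃, 0)`. -/
def formQ (R : Type*) [CommRing R] : Matrix Idx Idx R := Matrix.fromBlocks 0 1 1 0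

/-- The moment map `μ(M) = M Q Mᵗ J` of the `SL₂`-action on `2 × 6` matrices. -/
def momentMap {R : Type*} [CommRing R] (M : Matrix (Fin 2) Idx R) : Matrix (Fin 2) (Fin 2) R :=
  M * formQ R * M.transpose * formJ R

/-- The formula `ν(M) = Mᵗ J M Q` of the quotient map. -/
def nuMap {R : Type*} [CommRing R] (M : Matrix (Fin 2) Idx R) : Matrix Idx Idx R :=
  M.transpose * formJ R * M * formQ R

/-! ### The zero fibre of the moment map -/

/-- The generic matrix with two rows and columns indexed by `κ`. -/
def genM (κ : Type) : Matrix (Fin 2) κ (MvPolynomial (Fin 2 × κ) ℂ) :=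
  Matrix.mvPolynomialX (Fin 2) κ ℂ

/-- The ideal of the scheme-theoretic fibre `μ⁻¹(0)`, generated by the entries of `M Q Mᵗ J`. -/
def zeroFibreIdeal : Ideal (MvPolynomial (Fin 2 × Idx) ℂ) :=
  Ideal.span (Set.range fun p : Fin 2 × Fin 2 => momentMap (genM Idx) p.1 p.2)

/-- The coordinate ring `ℂ[μ⁻¹(0)]`. -/
abbrev ZeroFibreRing : Type := MvPolynomial (Fin 2 × Idx) ℂ ⧸ zeroFibreIdeal

/-! ### The nilpotent orbit and its closure -/

/-- The Pfaffian of the skew-symmetric `4 × 4` submatrix of `B` on the rows and columns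
`i, j, k, l` (zero when an index is repeated). -/
def pf4 {R : Type*} [CommRing R] (B : Matrix Idx Idx R) (i j k l : Idx) : R :=
  B i j * B k l - B i k * B j l + B i l * B j k

/-- The polynomial equations of
`{A ∈ 𝔰𝔬₆ | A² = 0, rk A ≤ 2, Pf₄(QA) = 0}`, where `𝔰𝔬₆ = {A | AᵗQ + QA = 0}`: an element of this
set is the left-hand side of one of the equations. -/
def closureEquations {R : Type*} [CommRing R] (A : Matrix Idx Idx R) : Set R :=
  (Set.range fun p : Idx × Idx => (A.transpose * formQ R + formQ R * A) p.1 p.2) ∪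
  (Set.range fun p : Idx × Idx => (A * A) p.1 p.2) ∪
  (Set.range fun p : (Fin 3 → Idx) × (Fin 3 → Idx) => (A.submatrix p.1 p.2).det) ∪
  (Set.range fun p : (Idx × Idx) × (Idx × Idx) =>
    pf4 (formQ R * A) p.1.1 p.1.2 p.2.1 p.2.2)

/-- The complex points of the orbit closure. -/
def orbitClosure : Set (Matrix Idx Idx ℂ) :=
  {A | ∀ f ∈ closureEquations A, f = 0}

/-- The generic `6 × 6` matrix. -/
def genA : Matrix Idx Idx (MvPolynomial (Idx × Idx) ℂ) := Matrix.mvPolynomialX Idx Idx ℂ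

/-- The ideal generated by the equations of the orbit closure. -/
def orbitClosureIdeal : Ideal (MvPolynomial (Idx × Idx) ℂ) :=
  Ideal.span (closureEquations genA)

/-- The coordinate ring of the orbit closure. -/
abbrev OrbitClosureRing : Type := MvPolynomial (Idx × Idx) ℂ ⧸ orbitClosureIdeal

/-- The matrix `A₀` with `a₁₅ = 1`, `a₂₄ = -1` and all other entries zero. It satisfies
`A₀² = 0` and has rank `2`, so it has Jordan type `[2², 1²]`. -/
def basePoint : Matrix Idx Idx ℂ :=
  Matrix.fromBlocks 0 !![0, 1, 0; -1, 0, 0; 0, 0, 0] 0 0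

/-- The nilpotent orbit `O_{[2²,1²]}`: the orbit of `A₀` under the adjoint action of
`SO₆ = {g | gᵗQg = Q, det g = 1}`. -/
def nilpotentOrbit : Set (Matrix Idx Idx ℂ) :=
  {A | ∃ g : Matrix Idx Idx ℂ, g.transpose * formQ ℂ * g = formQ ℂ ∧ g.det = 1 ∧
    A = g * basePoint * g⁻¹}

/-- `closureEquations` is compatible with ring homomorphisms. -/
theorem closureEquations_map {R S : Type*} [CommRing R] [CommRing S] (φ : R →+* S)
    (A : Matrix Idx Idx R) {f : R} (hf : f ∈ closureEquations A) :
    φ f ∈ closureEquations (A.map φ) := by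
  have hQ : formQ S = (formQ R).map φ := by
    ext (i | i) (j | j) <;> simp [formQ, Matrix.one_apply, apply_ite φ]
  rcases hf with ((⟨p, rfl⟩ | ⟨p, rfl⟩) | ⟨p, rfl⟩) | ⟨p, rfl⟩
  · refine Or.inl (Or.inl (Or.inl ⟨p, ?_⟩))
    simp [hQ, Matrix.mul_apply, Matrix.add_apply]
  · refine Or.inl (Or.inl (Or.inr ⟨p, ?_⟩))
    simp [Matrix.mul_apply]
  · refine Or.inl (Or.inr ⟨p, ?_⟩)
    simp only [RingHom.map_det, RingHom.mapMatrix_apply, Matrix.submatrix_map]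
  · refine Or.inr ⟨p, ?_⟩
    simp [pf4, hQ, Matrix.mul_apply]

/-- If `M Q Mᵗ J = 0`, then `Mᵗ J M Q` satisfies the equations of the orbit closure. -/
theorem closureEquations_nuMap {R : Type*} [CommRing R] (M : Matrix (Fin 2) Idx R)
    (hM : momentMap M = 0) : ∀ f ∈ closureEquations (nuMap M), f = 0 := by
  have hJ : formJ R * formJ R = -1 := by
    ext i j; fin_cases i <;> fin_cases j <;> simp [formJ]
  have hQ : formQ R * formQ R = 1 := by
    simp [formQ, Matrix.fromBlocks_multiply]
  have hQt : (formQ R).transpose = formQ R := by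
    simp [formQ, Matrix.fromBlocks_transpose]
  have hJt : (formJ R).transpose = -formJ R := by
    ext i j; fin_cases i <;> fin_cases j <;> simp [formJ]
  have h0 : M * formQ R * M.transpose = 0 := by
    have h := congrArg (· * formJ R) hM
    simp only [momentMap, Matrix.mul_assoc, hJ, Matrix.zero_mul] at h
    simpa [Matrix.mul_assoc] using h
  have hB : ∀ i j, (formQ R * nuMap M) i j =
      (M * formQ R) 0 i * (M * formQ R) 1 j - (M * formQ R) 1 i * (M * formQ R) 0 j := by
    have : formQ R * nuMap M = (M * formQ R).transpose * formJ R * (M * formQ R) := by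
      rw [Matrix.transpose_mul, hQt, nuMap]; simp only [Matrix.mul_assoc]
    intro i j
    rw [this]
    generalize M * formQ R = N
    simp [Matrix.mul_apply, Fin.sum_univ_two, formJ]
    ring
  rintro f (((⟨p, rfl⟩ | ⟨p, rfl⟩) | ⟨p, rfl⟩) | ⟨p, rfl⟩)
  · have : (nuMap M).transpose * formQ R + formQ R * nuMap M = 0 := by
      simp only [nuMap, Matrix.transpose_mul, Matrix.transpose_transpose, hQt, hJt,
        Matrix.mul_assoc, Matrix.neg_mul, Matrix.mul_neg]
      simp
    exact congrFun (congrFun this _) _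
  · have : nuMap M * nuMap M = 0 := by
      have : nuMap M * nuMap M =
          M.transpose * formJ R * (M * formQ R * M.transpose) * formJ R * M * formQ R := by
        simp only [nuMap, Matrix.mul_assoc]
      rw [this, h0]; simp
    exact congrFun (congrFun this _) _
  · have hA : ∀ i j, nuMap M i j =
        M 0 i * (M * formQ R) 1 j - M 1 i * (M * formQ R) 0 j := by
      have : nuMap M = M.transpose * formJ R * (M * formQ R) := by
        simp only [nuMap, Matrix.mul_assoc]
      intro i j
      rw [this]
      generalize M * formQ R = N
      simp [Matrix.mul_apply, Fin.sum_univ_two, formJ]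
      ring
    simp only [Matrix.det_fin_three, Matrix.submatrix_apply, hA]
    ring
  · simp only [pf4, hB]
    ring

theorem formQ_map {R S : Type*} [CommRing R] [CommRing S] (φ : R →+* S) :
    (formQ R).map φ = formQ S := by
  ext (i | i) (j | j) <;> simp [formQ, Matrix.one_apply, apply_ite φ]

theorem formJ_map {R S : Type*} [CommRing R] [CommRing S] (φ : R →+* S) :
    (formJ R).map φ = formJ S := by
  ext i j; fin_cases i <;> fin_cases j <;> simp [formJ]

theorem momentMap_map {R S : Type*} [CommRing R] [CommRing S] (φ : R →+* S)
    (M : Matrix (Fin 2) Idx R) : momentMap (M.map φ) = (momentMap M).map φ := by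
  simp only [momentMap, Matrix.map_mul, formQ_map, formJ_map, Matrix.transpose_map]

theorem nuMap_map {R S : Type*} [CommRing R] [CommRing S] (φ : R →+* S)
    (M : Matrix (Fin 2) Idx R) : nuMap (M.map φ) = (nuMap M).map φ := by
  simp only [nuMap, Matrix.map_mul, formQ_map, formJ_map, Matrix.transpose_map]

theorem momentMap_generic_eq_zero :
    momentMap ((genM Idx).map (Ideal.Quotient.mk zeroFibreIdeal)) = 0 := by
  rw [momentMap_map]
  ext i j
  exact Ideal.Quotient.eq_zero_iff_mem.mpr (Ideal.subset_span ⟨(i, j), rfl⟩)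

/-- The comorphism of `ν`: the coordinate `a_{ij}` is sent to the `(i, j)` entry of `Mᵗ J M Q`. -/
def nuComorphism : OrbitClosureRing →ₐ[ℂ] ZeroFibreRing :=
  Ideal.Quotient.liftₐ orbitClosureIdeal
    (MvPolynomial.aeval fun p : Idx × Idx =>
      nuMap ((genM Idx).map (Ideal.Quotient.mk zeroFibreIdeal)) p.1 p.2) (by
    intro a ha
    have hle : orbitClosureIdeal ≤ RingHom.ker (MvPolynomial.aeval (R := ℂ) fun p : Idx × Idx =>
        nuMap ((genM Idx).map (Ideal.Quotient.mk zeroFibreIdeal)) p.1 p.2).toRingHom := by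
      refine Ideal.span_le.mpr fun f hf => ?_
      have h := closureEquations_map (MvPolynomial.aeval (R := ℂ) fun p : Idx × Idx =>
        nuMap ((genM Idx).map (Ideal.Quotient.mk zeroFibreIdeal)) p.1 p.2).toRingHom genA hf
      have hA : genA.map (MvPolynomial.aeval (R := ℂ) fun p : Idx × Idx =>
          nuMap ((genM Idx).map (Ideal.Quotient.mk zeroFibreIdeal)) p.1 p.2).toRingHom =
          nuMap ((genM Idx).map (Ideal.Quotient.mk zeroFibreIdeal)) := by
        ext i j; simp [genA]
      rw [hA] at h
      exact closureEquations_nuMap _ momentMap_generic_eq_zero _ h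
    exact hle ha)

/-- The affine scheme `μ⁻¹(0)`. -/
def zeroFibre : Scheme := Spec (CommRingCat.of ZeroFibreRing)

/-- The orbit closure as an affine scheme. -/
def orbitClosureScheme : Scheme := Spec (CommRingCat.of OrbitClosureRing)

/-- The morphism `ν : μ⁻¹(0) → Ō_{[2²,1²]}`, `M ↦ Mᵗ J M Q`. -/
def nu : zeroFibre ⟶ orbitClosureScheme :=
  Spec.map (CommRingCat.ofHom nuComorphism.toRingHom)

/-- Evaluation of functions on the orbit closure at one of its complex points. -/
def evalAt (A : Matrix Idx Idx ℂ) (hA : A ∈ orbitClosure) : OrbitClosureRing →ₐ[ℂ] ℂ :=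
  Ideal.Quotient.liftₐ orbitClosureIdeal
    (MvPolynomial.aeval fun p : Idx × Idx => A p.1 p.2) (by
    intro a ha
    have hle : orbitClosureIdeal ≤ RingHom.ker
        (MvPolynomial.aeval (R := ℂ) fun p : Idx × Idx => A p.1 p.2).toRingHom := by
      refine Ideal.span_le.mpr fun f hf => ?_
      have h := closureEquations_map
        (MvPolynomial.aeval (R := ℂ) fun p : Idx × Idx => A p.1 p.2).toRingHom genA hf
      have hA' : genA.map
          (MvPolynomial.aeval (R := ℂ) fun p : Idx × Idx => A p.1 p.2).toRingHom = A := by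
        ext i j; simp [genA]
      rw [hA'] at h
      exact hA _ h
    exact hle ha)

/-- The closed point of the scheme given by a complex point. -/
def closedPoint (A : Matrix Idx Idx ℂ) (hA : A ∈ orbitClosure) : orbitClosureScheme :=
  PrimeSpectrum.comap (evalAt A hA).toRingHom ⊥

/-- The ideal of the scheme-theoretic fibre `ν⁻¹(A)` in `ℂ[μ⁻¹(0)]`: the extension of the maximal
ideal of `A`. -/
def fibreIdeal (A : Matrix Idx Idx ℂ) (hA : A ∈ orbitClosure) : Ideal ZeroFibreRing :=
  (RingHom.ker (evalAt A hA).toRingHom).map nuComorphism.toRingHom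

/-- The coordinate ring of the scheme-theoretic fibre `ν⁻¹(A)`. -/
abbrev FibreRing (A : Matrix Idx Idx ℂ) (hA : A ∈ orbitClosure) : Type :=
  ZeroFibreRing ⧸ fibreIdeal A hA

/-- The coordinate ring of the variety `SL₂`. -/
abbrev SL2Ring : Type :=
  MvPolynomial (Fin 2 × Fin 2) ℂ ⧸ Ideal.span {(genM (Fin 2)).det - 1}

/-! ### The action of `SL₂` -/

/-- The matrix `g` with its entries viewed as constant polynomials. -/
def scalarMatrix (κ : Type) (g : SL(2, ℂ)) :
    Matrix (Fin 2) (Fin 2) (MvPolynomial (Fin 2 × κ) ℂ) :=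
  MvPolynomial.C.mapMatrix (g : Matrix (Fin 2) (Fin 2) ℂ)

theorem scalarMatrix_det (κ : Type) (g : SL(2, ℂ)) : (scalarMatrix κ g).det = 1 := by
  rw [scalarMatrix, ← RingHom.map_det, g.2, map_one]

/-- The matrix `g⁻¹ X` of linear forms, where `X` is the generic matrix. -/
def translated (κ : Type) (g : SL(2, ℂ)) : Matrix (Fin 2) κ (MvPolynomial (Fin 2 × κ) ℂ) :=
  scalarMatrix κ g⁻¹ * genM κ

/-- The action of `SL₂(ℂ)` on polynomial functions on matrices with two rows, induced by left
multiplication: `(g f)(M) = f(g⁻¹ M)`. -/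
def polyAction (κ : Type) :
    SL(2, ℂ) →* (MvPolynomial (Fin 2 × κ) ℂ →ₐ[ℂ] MvPolynomial (Fin 2 × κ) ℂ) where
  toFun g := MvPolynomial.aeval fun p => translated κ g p.1 p.2
  map_one' := by
    ext p : 1
    have e : scalarMatrix κ (1 : SL(2, ℂ))⁻¹ = 1 := by
      rw [scalarMatrix, inv_one, Matrix.SpecialLinearGroup.coe_one, map_one]
    rw [translated, e, Matrix.one_mul]
    simp [genM]
  map_mul' g h := by
    ext p : 1
    have e : ∀ k : SL(2, ℂ), translated κ k = scalarMatrix κ k⁻¹ * genM κ := fun _ => rfl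
    have hm : scalarMatrix κ (g * h)⁻¹ = scalarMatrix κ h⁻¹ * scalarMatrix κ g⁻¹ := by
      simp only [scalarMatrix, mul_inv_rev, Matrix.SpecialLinearGroup.coe_mul, map_mul]
    rw [MvPolynomial.aeval_X, e (g * h), hm, AlgHom.mul_apply, MvPolynomial.aeval_X, e h,
      Matrix.mul_assoc, ← e g, Matrix.mul_apply, Matrix.mul_apply, map_sum]
    refine Finset.sum_congr rfl fun k _ => ?_
    simp [scalarMatrix, genM, MvPolynomial.algHom_C]

/-- An action by algebra endomorphisms descends to the quotient by a stable ideal. -/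
def quotientAction {B : Type*} [CommRing B] [Algebra ℂ B] (ρ : SL(2, ℂ) →* (B →ₐ[ℂ] B))
    (I : Ideal B) (hI : ∀ g, I ≤ I.comap (ρ g)) : SL(2, ℂ) →* (B ⧸ I →ₐ[ℂ] B ⧸ I) where
  toFun g := Ideal.quotientMapₐ I (ρ g) (hI g)
  map_one' := by
    apply Ideal.Quotient.algHom_ext
    ext x
    simp
  map_mul' g h := by
    apply Ideal.Quotient.algHom_ext
    ext x
    simp

theorem polyAction_map (κ : Type) (g : SL(2, ℂ)) :
    (genM κ).map (polyAction κ g) = translated κ g := by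
  ext i j : 2
  simp [genM, polyAction]

theorem transpose_mul_formJ_mul {R : Type*} [CommRing R] (G : Matrix (Fin 2) (Fin 2) R)
    (hG : G.det = 1) : G.transpose * formJ R * G = formJ R := by
  rw [Matrix.det_fin_two] at hG
  ext i j
  fin_cases i <;> fin_cases j <;> simp [formJ, Matrix.mul_apply, Fin.sum_univ_two]
  · ring
  · linear_combination hG
  · linear_combination -hG
  · ring

theorem momentMap_mul {R : Type*} [CommRing R] (G : Matrix (Fin 2) (Fin 2) R)
    (hG : G.det = 1) (M : Matrix (Fin 2) Idx R) :
    momentMap (G * M) = G * momentMap M * G.adjugate := by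
  have h : G.transpose * formJ R = formJ R * G.adjugate := by
    calc G.transpose * formJ R = G.transpose * formJ R * (G * G.adjugate) := by
          rw [Matrix.mul_adjugate, hG, one_smul, Matrix.mul_one]
      _ = G.transpose * formJ R * G * G.adjugate := by simp only [Matrix.mul_assoc]
      _ = formJ R * G.adjugate := by rw [transpose_mul_formJ_mul G hG]
  simp only [momentMap, Matrix.transpose_mul, Matrix.mul_assoc, h]

theorem nuMap_mul {R : Type*} [CommRing R] (G : Matrix (Fin 2) (Fin 2) R)
    (hG : G.det = 1) (M : Matrix (Fin 2) Idx R) : nuMap (G * M) = nuMap M := by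
  have : nuMap (G * M) = M.transpose * (G.transpose * formJ R * G) * M * formQ R := by
    simp only [nuMap, Matrix.transpose_mul, Matrix.mul_assoc]
  rw [this, transpose_mul_formJ_mul G hG, nuMap]

theorem zeroFibreIdeal_stable (g : SL(2, ℂ)) :
    zeroFibreIdeal ≤ zeroFibreIdeal.comap (polyAction Idx g) := by
  refine Ideal.span_le.mpr ?_
  rintro _ ⟨p, rfl⟩
  have h : (momentMap (genM Idx)).map (polyAction Idx g).toRingHom =
      scalarMatrix Idx g⁻¹ * momentMap (genM Idx) * (scalarMatrix Idx g⁻¹).adjugate := by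
    rw [← momentMap_map, ← momentMap_mul _ (scalarMatrix_det Idx g⁻¹)]
    exact congrArg momentMap (polyAction_map Idx g)
  have h2 : polyAction Idx g (momentMap (genM Idx) p.1 p.2) =
      (scalarMatrix Idx g⁻¹ * momentMap (genM Idx) * (scalarMatrix Idx g⁻¹).adjugate) p.1 p.2 :=
    congrFun (congrFun h p.1) p.2
  change polyAction Idx g (momentMap (genM Idx) p.1 p.2) ∈ zeroFibreIdeal
  rw [h2, Matrix.mul_apply]
  refine Ideal.sum_mem _ fun k _ => Ideal.mul_mem_right _ _ ?_
  rw [Matrix.mul_apply]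
  exact Ideal.sum_mem _ fun l _ => Ideal.mul_mem_left _ _ (Ideal.subset_span ⟨(l, k), rfl⟩)

/-- The action of `SL₂(ℂ)` on `ℂ[μ⁻¹(0)]`. -/
def zeroFibreAction : SL(2, ℂ) →* (ZeroFibreRing →ₐ[ℂ] ZeroFibreRing) :=
  quotientAction (polyAction Idx) zeroFibreIdeal zeroFibreIdeal_stable

/-- The morphism `ν` is `SL₂`-invariant. -/
theorem zeroFibreAction_nuComorphism (g : SL(2, ℂ)) (s : OrbitClosureRing) :
    zeroFibreAction g (nuComorphism s) = nuComorphism s := by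
  have h : (zeroFibreAction g).comp nuComorphism = nuComorphism := by
    apply Ideal.Quotient.algHom_ext
    ext p : 1
    have e : ∀ p : Idx × Idx, nuComorphism (Ideal.Quotient.mk orbitClosureIdeal
        (MvPolynomial.X p)) = Ideal.Quotient.mk zeroFibreIdeal (nuMap (genM Idx) p.1 p.2) := by
      intro p
      change MvPolynomial.aeval _ (MvPolynomial.X p) = _
      rw [MvPolynomial.aeval_X, nuMap_map]
      rfl
    change zeroFibreAction g (nuComorphism (Ideal.Quotient.mk orbitClosureIdeal
      (MvPolynomial.X p))) = nuComorphism (Ideal.Quotient.mk orbitClosureIdeal (MvPolynomial.X p))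
    rw [e]
    have h1 : (nuMap (genM Idx)).map (polyAction Idx g).toRingHom = nuMap (genM Idx) := by
      rw [← nuMap_map, ← nuMap_mul _ (scalarMatrix_det Idx g⁻¹) (genM Idx)]
      exact congrArg nuMap (polyAction_map Idx g)
    have h2 : polyAction Idx g (nuMap (genM Idx) p.1 p.2) = nuMap (genM Idx) p.1 p.2 :=
      congrFun (congrFun h1 p.1) p.2
    change Ideal.Quotient.mk zeroFibreIdeal (polyAction Idx g (nuMap (genM Idx) p.1 p.2)) = _
    rw [h2]
  exact DFunLike.congr_fun h s

theorem fibreIdeal_stable (A : Matrix Idx Idx ℂ) (hA : A ∈ orbitClosure) (g : SL(2, ℂ)) :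
    fibreIdeal A hA ≤ (fibreIdeal A hA).comap (zeroFibreAction g) := by
  refine Ideal.map_le_iff_le_comap.mpr fun s hs => ?_
  simp only [Ideal.mem_comap]
  have h := zeroFibreAction_nuComorphism g s
  change zeroFibreAction g (nuComorphism s) ∈ _
  rw [h]
  exact Ideal.mem_map_of_mem nuComorphism.toRingHom hs

/-- The action of `SL₂(ℂ)` on the coordinate ring of the fibre `ν⁻¹(A)`. -/
def fibreAction (A : Matrix Idx Idx ℂ) (hA : A ∈ orbitClosure) :
    SL(2, ℂ) →* (FibreRing A hA →ₐ[ℂ] FibreRing A hA) :=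
  quotientAction zeroFibreAction (fibreIdeal A hA) (fibreIdeal_stable A hA)

/-- The coordinate ring of the fibre `ν⁻¹(A)` as a representation of `SL₂(ℂ)`. -/
def fibreRep (A : Matrix Idx Idx ℂ) (hA : A ∈ orbitClosure) :
    Representation ℂ SL(2, ℂ) (FibreRing A hA) :=
  (AlgHom.toEnd (R := ℂ) (A := FibreRing A hA)).comp (fibreAction A hA)

theorem detIdeal_stable (g : SL(2, ℂ)) :
    Ideal.span {(genM (Fin 2)).det - 1} ≤
      (Ideal.span {(genM (Fin 2)).det - 1}).comap (polyAction (Fin 2) g) := by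
  refine Ideal.span_le.mpr ?_
  rintro _ rfl
  have h : polyAction (Fin 2) g (genM (Fin 2)).det = (genM (Fin 2)).det := by
    have h1 : polyAction (Fin 2) g (genM (Fin 2)).det =
        ((genM (Fin 2)).map (polyAction (Fin 2) g)).det :=
      AlgHom.map_det (polyAction (Fin 2) g) (genM (Fin 2))
    rw [h1, polyAction_map, translated, Matrix.det_mul, scalarMatrix_det, one_mul]
  change polyAction (Fin 2) g ((genM (Fin 2)).det - 1) ∈
    Ideal.span {(genM (Fin 2)).det - 1}
  rw [map_sub, h, map_one]
  exact Ideal.subset_span rfl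

/-- The action of `SL₂(ℂ)` on `ℂ[SL₂]` induced by left multiplication. -/
def sl2Action : SL(2, ℂ) →* (SL2Ring →ₐ[ℂ] SL2Ring) :=
  quotientAction (polyAction (Fin 2)) _ detIdeal_stable

/-- The space `ℂ[x, y]_d` of binary forms of degree `d`: homogeneous polynomial functions of
degree `d` on column vectors with two entries. -/
abbrev BinaryForms (d : ℕ) : Submodule ℂ (MvPolynomial (Fin 2 × Unit) ℂ) :=
  MvPolynomial.homogeneousSubmodule (Fin 2 × Unit) ℂ d

theorem binaryForms_stable (d : ℕ) (g : SL(2, ℂ)) :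
    ∀ f ∈ BinaryForms d, (polyAction Unit g).toLinearMap f ∈ BinaryForms d := by
  intro f hf
  have h : ∀ p : Fin 2 × Unit, (translated Unit g p.1 p.2).IsHomogeneous 1 := by
    intro p
    rw [translated, Matrix.mul_apply]
    refine MvPolynomial.IsHomogeneous.sum _ _ _ fun k _ => ?_
    simpa [scalarMatrix, genM] using
      MvPolynomial.isHomogeneous_C_mul_X (R := ℂ) ((g⁻¹ : SL(2, ℂ)).1 p.1 k) (k, p.2)
  have h2 := MvPolynomial.IsHomogeneous.aeval (hφ := hf) _ h
  simpa [polyAction] using h2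

/-- The irreducible representation `V_d = ℂ[x, y]_d` of `SL₂(ℂ)`, of dimension `d + 1`. -/
def binaryFormsRep (d : ℕ) : Representation ℂ SL(2, ℂ) (BinaryForms d) where
  toFun g := (polyAction Unit g).toLinearMap.restrict (binaryForms_stable d g)
  map_one' := by
    ext f : 2
    simp
  map_mul' g h := by
    ext f : 2
    simp [LinearMap.restrict_apply]

/-- The multiplicity `dim Hom_{SL₂}(V_d, ℂ[ν⁻¹(A)])`, that is, the value at `d` of the Hilbert
function of the fibre `ν⁻¹(A)` (as a cardinal, so that infinite multiplicities are not hidden). -/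
def multiplicity (A : Matrix Idx Idx ℂ) (hA : A ∈ orbitClosure) (d : ℕ) : Cardinal :=
  Module.rank ℂ ((binaryFormsRep d).IntertwiningMap (fibreRep A hA))

end SymplecticReduction

end

noncomputable section

namespace SymplecticReduction

/-! ### Coordinates -/

section Coordinates

variable {R : Type*} [CommRing R]

/-! Replace `A` by the bivector `c = AQ`. Membership in the orthogonal Lie algebra says that `c` is
skew, the Pfaffians are the Plücker relations, and `A² = 0` says that the rows of `c` span an
isotropic subspace. In these terms `ν` sends a matrix with rows `p, q` to `p ∧ q`, and `μ = 0` says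
that `p, q` span an isotropic subspace.

Where `c_{ij}` is invertible, `ν` has the explicit section `sectionMatrix`, whose columns `i, j` are
`(1, 0)` and `(0, c_{ij})`. Every `M` over such a point is `g` times the section for a unique `g` of
determinant one, read off from columns `i, j` of `M` (`transporter`). These formulas hold over every
`ℂ`-algebra, so `ν` is a trivial `SL₂`-bundle there. This yields the equivariant isomorphism of each
fibre with `SL₂` (`exists_fibre_equiv`), and flatness, since the functions upstairs form the
coproduct with `ℂ[SL₂]` over the field `ℂ` (`exists_equiv_of_coord_isUnit`).

For the orbit, a nonzero `A` equals `p ∧ q` with `p, q` isotropic, and after an even permutation of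
coordinates `p, q` are the first two columns of an explicit element of `SO₆` (`mem_nilpotentOrbit`).
The open set where some `c_{ij}` is nonzero is reduced because its charts factor through a
polynomial ring in six variables, and dense because a curve in it degenerates to the origin.

The Hilbert function is Frobenius reciprocity: evaluation at `1` identifies the equivariant maps
from `V_d` to `ℂ[SL₂]` with the dual of `V_d` (`multiplicity_eq`). -/

theorem mul_formQ_apply {κ : Type*} (M : Matrix κ Idx R) (i : κ) (l : Idx) :
    (M * formQ R) i l = M i l.swap := by
  rcases l with l | l <;> simp [Matrix.mul_apply, formQ, Matrix.one_apply]

theorem formQ_mul_apply {κ : Type*} (M : Matrix Idx κ R) (k : Idx) (l : κ) :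
    (formQ R * M) k l = M k.swap l := by
  rcases k with k | k <;> simp [Matrix.mul_apply, formQ, Matrix.one_apply]

theorem formQ_mul_formQ : formQ R * formQ R = 1 := by
  simp [formQ, Matrix.fromBlocks_multiply]

theorem formJ_mul_formJ : formJ R * formJ R = -1 := by
  ext i j; fin_cases i <;> fin_cases j <;> simp [formJ]

theorem nuMap_apply (M : Matrix (Fin 2) Idx R) (k l : Idx) :
    nuMap M k l = M 0 k * M 1 l.swap - M 1 k * M 0 l.swap := by
  rw [nuMap, mul_formQ_apply]
  simp [Matrix.mul_apply, Fin.sum_univ_two, formJ]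
  ring

/-- The factor `J` is invertible, so only the Gram matrix of the rows with respect to `Q` matters.
-/
theorem momentMap_eq_zero_iff (M : Matrix (Fin 2) Idx R) :
    momentMap M = 0 ↔ ∀ a b, ∑ k, M a k * M b k.swap = 0 := by
  have h : momentMap M = 0 ↔ M * formQ R * M.transpose = 0 := by
    refine ⟨fun h => ?_, fun h => by rw [momentMap, h, Matrix.zero_mul]⟩
    have h' := congrArg (· * formJ R) h
    simpa [momentMap, Matrix.mul_assoc, formJ_mul_formJ] using h'
  have e : ∀ a b, (M * formQ R * M.transpose) a b = ∑ k, M a k * M b k.swap := fun a b => by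
    rw [Matrix.mul_apply, ← (Equiv.sumComm (Fin 3) (Fin 3)).sum_comp]
    refine Finset.sum_congr rfl fun k _ => ?_
    rw [mul_formQ_apply]
    simp
  rw [h]
  exact ⟨fun h a b => by rw [← e, h]; rfl, fun h => by ext a b; rw [e, h]; rfl⟩

/-- The coordinate `c_{ij}` of the bivector `A Q`. -/
def coord (A : Matrix Idx Idx R) (i j : Idx) : R := A i j.swap

theorem coord_nuMap (M : Matrix (Fin 2) Idx R) (k l : Idx) :
    coord (nuMap M) k l = M 0 k * M 1 l - M 1 k * M 0 l := by
  rw [coord, nuMap_apply, Sum.swap_swap]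

theorem ext_coord {S : Type*} {A B : Matrix Idx Idx S}
    (h : ∀ k l, coord A k l = coord B k l) : A = B := by
  ext k l
  simpa [coord] using h k l.swap

/-- The rings here may have zero divisors and nilpotents, so `2` is cancelled through its inverse in
`ℂ`. -/
theorem eq_zero_of_add_self [Algebra ℂ R] {x : R} (h : x + x = 0) : x = 0 := by
  have h2 : algebraMap ℂ R (1 / 2) * 2 = 1 := by
    rw [← map_ofNat (algebraMap ℂ R) 2, ← map_mul]; norm_num
  linear_combination algebraMap ℂ R (1 / 2) * h - x * h2

/-! ### The defining equations in the coordinates `c_{ij}` -/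

section Equations

variable {A : Matrix Idx Idx R} (hA : ∀ f ∈ closureEquations A, f = 0)
include hA

theorem coord_skew (i j : Idx) : coord A i j = -coord A j i := by
  have h := hA _ (Or.inl (Or.inl (Or.inl ⟨(j.swap, i.swap), rfl⟩)))
  simp only [Matrix.add_apply, mul_formQ_apply, formQ_mul_apply, Matrix.transpose_apply,
    Sum.swap_swap] at h
  simp only [coord]
  linear_combination h

theorem coord_self [Algebra ℂ R] (i : Idx) : coord A i i = 0 := by
  refine eq_zero_of_add_self ?_
  linear_combination coord_skew hA i i

theorem coord_plucker (i j k l : Idx) :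
    coord A i j * coord A k l = coord A i k * coord A j l - coord A i l * coord A j k := by
  -- The Pfaffians are those of `QA = Q(AQ)Q`, whose entries are the `c_{ij}` with both indices
  -- swapped.
  have h := hA _ (Or.inr ⟨((i.swap, j.swap), (k.swap, l.swap)), rfl⟩)
  simp only [pf4, formQ_mul_apply, Sum.swap_swap] at h
  simp only [coord]
  linear_combination h

theorem coord_isotropic (i j : Idx) : ∑ k, coord A i k * coord A j k.swap = 0 := by
  have h := hA _ (Or.inl (Or.inl (Or.inr ⟨(i, j.swap), rfl⟩)))
  simp only [Matrix.mul_apply] at h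
  rw [← (Equiv.sumComm (Fin 3) (Fin 3)).sum_comp] at h
  rw [← neg_eq_zero, ← h, ← Finset.sum_neg_distrib]
  refine Finset.sum_congr rfl fun k _ => ?_
  rw [coord_skew hA j]
  simp [coord]

end Equations

/-- The matrix with rows `(c_{kj} b')_k` and `(c_{ik})_k`. If `c_{ij} b' = 1`, it is mapped to `A`
by `ν`. -/
def sectionMatrix (A : Matrix Idx Idx R) (i j : Idx) (b' : R) : Matrix (Fin 2) Idx R :=
  Matrix.of ![fun k => coord A k j * b', fun k => coord A i k]

theorem sectionMatrix_zero (A : Matrix Idx Idx R) (i j : Idx) (b' : R) (k : Idx) :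
    sectionMatrix A i j b' 0 k = coord A k j * b' := rfl

theorem sectionMatrix_one (A : Matrix Idx Idx R) (i j : Idx) (b' : R) (k : Idx) :
    sectionMatrix A i j b' 1 k = coord A i k := rfl

theorem coord_map {S T : Type*} (φ : S → T) (A : Matrix Idx Idx S) (i j : Idx) :
    coord (A.map φ) i j = φ (coord A i j) := rfl

theorem sectionMatrix_map {S : Type*} [CommRing S] (φ : R →+* S) (A : Matrix Idx Idx R)
    (i j : Idx) (b' : R) :
    (sectionMatrix A i j b').map φ = sectionMatrix (A.map φ) i j (φ b') := by
  ext a k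
  fin_cases a
  · simp [sectionMatrix, coord_map φ]
  · simp [sectionMatrix, coord_map φ]

/-- This is the Plücker relation `c_{ij} c_{kl} = c_{kj} c_{il} - c_{ik} c_{lj}`, divided by
`c_{ij}`. -/
theorem nuMap_sectionMatrix {A : Matrix Idx Idx R} (hA : ∀ f ∈ closureEquations A, f = 0)
    {i j : Idx} {b' : R} (hb : coord A i j * b' = 1) : nuMap (sectionMatrix A i j b') = A := by
  refine ext_coord fun k l => ?_
  rw [coord_nuMap]
  simp only [sectionMatrix_zero, sectionMatrix_one]
  linear_combination coord A k l * hb - b' * coord_plucker hA i j k l +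
    b' * coord A i l * coord_skew hA k j - b' * coord A i k * coord_skew hA l j

/-- Up to scalars the two rows are rows `j` and `i` of `c`, which are isotropic and orthogonal
because `A² = 0`. -/
theorem momentMap_sectionMatrix {A : Matrix Idx Idx R} (hA : ∀ f ∈ closureEquations A, f = 0)
    (i j : Idx) (b' : R) : momentMap (sectionMatrix A i j b') = 0 := by
  have e : ∀ k, sectionMatrix A i j b' 0 k = -b' * coord A j k := fun k => by
    rw [sectionMatrix_zero, coord_skew hA k j]; ring
  rw [momentMap_eq_zero_iff]
  intro a b
  fin_cases a <;> fin_cases b <;>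
    simp only [Fin.zero_eta, Fin.mk_one, e, sectionMatrix_one]
  · rw [← mul_zero (b' * b'), ← coord_isotropic hA j j, Finset.mul_sum]
    exact Finset.sum_congr rfl fun k _ => by ring
  · rw [← mul_zero (-b'), ← coord_isotropic hA j i, Finset.mul_sum]
    exact Finset.sum_congr rfl fun k _ => by ring
  · rw [← mul_zero (-b'), ← coord_isotropic hA i j, Finset.mul_sum]
    exact Finset.sum_congr rfl fun k _ => by ring
  · exact coord_isotropic hA i i

/-- The matrix `g` for which `M = g * sectionMatrix (nuMap M) i j b'`. -/
def transporter (M : Matrix (Fin 2) Idx R) (i j : Idx) (b' : R) : Matrix (Fin 2) (Fin 2) R :=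
  Matrix.of fun a => ![M a i, M a j * b']

theorem det_transporter (M : Matrix (Fin 2) Idx R) {i j : Idx} {b' : R}
    (hb : coord (nuMap M) i j * b' = 1) : (transporter M i j b').det = 1 := by
  rw [coord_nuMap] at hb
  simp only [transporter, Matrix.det_fin_two, Matrix.of_apply, Matrix.cons_val_zero,
    Matrix.cons_val_one]
  linear_combination hb

/-- Cramer's rule: every column of `M` is a combination of columns `i` and `j`, with quotients of `2
× 2` minors as coefficients. -/
theorem transporter_mul_sectionMatrix (M : Matrix (Fin 2) Idx R) {i j : Idx} {b' : R}
    (hb : coord (nuMap M) i j * b' = 1) :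
    transporter M i j b' * sectionMatrix (nuMap M) i j b' = M := by
  rw [coord_nuMap] at hb
  ext a k
  rw [Matrix.mul_apply, Fin.sum_univ_two, sectionMatrix_zero, sectionMatrix_one, coord_nuMap,
    coord_nuMap]
  simp only [transporter, Matrix.of_apply, Matrix.cons_val_zero, Matrix.cons_val_one]
  fin_cases a <;> simp only [Fin.zero_eta, Fin.mk_one]
  · linear_combination M 0 k * hb
  · linear_combination M 1 k * hb

/-- Columns `i, j` of the section form `diag(1, c_{ij})`, so `X` can be recovered from its product
with the section. This is the uniqueness of the transporter. -/
theorem transporter_mul (X : Matrix (Fin 2) (Fin 2) R) {A : Matrix Idx Idx R} {i j : Idx} {b' : R}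
    (hi : coord A i i = 0) (hj : coord A j j = 0) (hb : coord A i j * b' = 1) :
    transporter (X * sectionMatrix A i j b') i j b' = X := by
  ext a c
  fin_cases c
  · simp [transporter, Matrix.mul_apply, Fin.sum_univ_two, sectionMatrix_zero, sectionMatrix_one,
      hi, hb]
  · simp [transporter, Matrix.mul_apply, Fin.sum_univ_two, sectionMatrix_zero, sectionMatrix_one,
      hj, hb, mul_assoc]

theorem transporter_map {S : Type*} [CommRing S] (φ : R →+* S) (M : Matrix (Fin 2) Idx R)
    (i j : Idx) (b' : R) :
    (transporter M i j b').map φ = transporter (M.map φ) i j (φ b') := by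
  ext a c
  fin_cases c <;> simp [transporter]

end Coordinates

/-! ### Universal matrices and universal properties -/

section Universal

variable {S : Type*} [CommRing S] [Algebra ℂ S]

/-- The structure map of a `ℂ`-algebra. -/
abbrev scalarMap (S : Type*) [CommRing S] [Algebra ℂ S] : ℂ →+* S := algebraMap ℂ S

/-- The universal matrix over the zero fibre of the moment map. -/
def zeroFibreMatrix : Matrix (Fin 2) Idx ZeroFibreRing :=
  (genM Idx).map (Ideal.Quotient.mk zeroFibreIdeal)

/-- The universal matrix over the orbit closure. -/
def orbitMatrix : Matrix Idx Idx OrbitClosureRing :=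
  genA.map (Ideal.Quotient.mk orbitClosureIdeal)

/-- The universal matrix over `SL₂`. -/
def sl2Matrix : Matrix (Fin 2) (Fin 2) SL2Ring :=
  (genM (Fin 2)).map (Ideal.Quotient.mk (Ideal.span {(genM (Fin 2)).det - 1}))

theorem momentMap_zeroFibreMatrix : momentMap zeroFibreMatrix = 0 := momentMap_generic_eq_zero

/-- Complements `closureEquations_map`: no equations beyond the images appear after base change, so
solutions map to solutions. -/
theorem closureEquations_map_subset {R T : Type*} [CommRing R] [CommRing T] (φ : R →+* T)
    (A : Matrix Idx Idx R) : closureEquations (A.map φ) ⊆ φ '' closureEquations A := by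
  rintro f (((⟨p, rfl⟩ | ⟨p, rfl⟩) | ⟨p, rfl⟩) | ⟨p, rfl⟩)
  · refine ⟨_, Or.inl (Or.inl (Or.inl ⟨p, rfl⟩)), ?_⟩
    simp [mul_formQ_apply, formQ_mul_apply]
  · refine ⟨_, Or.inl (Or.inl (Or.inr ⟨p, rfl⟩)), ?_⟩
    simp [Matrix.mul_apply]
  · refine ⟨_, Or.inl (Or.inr ⟨p, rfl⟩), ?_⟩
    simp only [RingHom.map_det, RingHom.mapMatrix_apply, Matrix.submatrix_map]
  · refine ⟨_, Or.inr ⟨p, rfl⟩, ?_⟩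
    simp [pf4, formQ_mul_apply]

theorem closureEquations_orbitMatrix : ∀ f ∈ closureEquations orbitMatrix, f = 0 := by
  intro f hf
  obtain ⟨f, hf', rfl⟩ := closureEquations_map_subset (Ideal.Quotient.mk orbitClosureIdeal) genA hf
  exact Ideal.Quotient.eq_zero_iff_mem.mpr (Ideal.subset_span hf')

theorem det_sl2Matrix : sl2Matrix.det = 1 := by
  have h : Ideal.Quotient.mk (Ideal.span {(genM (Fin 2)).det - 1}) ((genM (Fin 2)).det - 1) = 0 :=
    Ideal.Quotient.eq_zero_iff_mem.mpr (Ideal.subset_span rfl)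
  rw [map_sub, map_one, sub_eq_zero, RingHom.map_det] at h
  exact h

theorem orbitMatrix_map_nuComorphism :
    orbitMatrix.map nuComorphism = nuMap zeroFibreMatrix := by
  ext i j
  change MvPolynomial.aeval _ (MvPolynomial.X (i, j)) = _
  rw [MvPolynomial.aeval_X]
  rfl

/-- A matrix over a `ℂ`-algebra `S` in the zero fibre of the moment map is an `S`-valued point. -/
def zeroFibreLift (M : Matrix (Fin 2) Idx S) (hM : momentMap M = 0) : ZeroFibreRing →ₐ[ℂ] S :=
  Ideal.Quotient.liftₐ zeroFibreIdeal (MvPolynomial.aeval fun p => M p.1 p.2) (by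
    intro a ha
    have hle : zeroFibreIdeal ≤ RingHom.ker
        (MvPolynomial.aeval (R := ℂ) fun p : Fin 2 × Idx => M p.1 p.2).toRingHom := by
      refine Ideal.span_le.mpr ?_
      rintro _ ⟨p, rfl⟩
      have h := momentMap_map
        (MvPolynomial.aeval (R := ℂ) fun p : Fin 2 × Idx => M p.1 p.2).toRingHom (genM Idx)
      have e : (genM Idx).map (MvPolynomial.aeval (R := ℂ)
          fun p : Fin 2 × Idx => M p.1 p.2).toRingHom = M := by
        ext i j; simp [genM]
      rw [e, hM] at h
      exact (congrFun (congrFun h p.1) p.2).symm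
    exact hle ha)

theorem zeroFibreMatrix_map_lift (M : Matrix (Fin 2) Idx S) (hM : momentMap M = 0) :
    zeroFibreMatrix.map (zeroFibreLift M hM) = M := by
  ext i j
  change MvPolynomial.aeval _ (MvPolynomial.X (i, j)) = _
  rw [MvPolynomial.aeval_X]

theorem zeroFibre_algHom_ext {f g : ZeroFibreRing →ₐ[ℂ] S}
    (h : zeroFibreMatrix.map f = zeroFibreMatrix.map g) : f = g := by
  apply Ideal.Quotient.algHom_ext
  ext p : 1
  exact congrFun (congrFun h p.1) p.2

/-- A matrix over a `ℂ`-algebra `S` that satisfies the equations of the orbit closure is an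
`S`-valued point. -/
def orbitLift (A : Matrix Idx Idx S) (hA : ∀ f ∈ closureEquations A, f = 0) :
    OrbitClosureRing →ₐ[ℂ] S :=
  Ideal.Quotient.liftₐ orbitClosureIdeal (MvPolynomial.aeval fun p => A p.1 p.2) (by
    intro a ha
    have hle : orbitClosureIdeal ≤ RingHom.ker
        (MvPolynomial.aeval (R := ℂ) fun p : Idx × Idx => A p.1 p.2).toRingHom := by
      refine Ideal.span_le.mpr fun f hf => ?_
      have h := closureEquations_map
        (MvPolynomial.aeval (R := ℂ) fun p : Idx × Idx => A p.1 p.2).toRingHom genA hf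
      have hA' : genA.map
          (MvPolynomial.aeval (R := ℂ) fun p : Idx × Idx => A p.1 p.2).toRingHom = A := by
        ext i j; simp [genA]
      rw [hA'] at h
      exact hA _ h
    exact hle ha)

theorem orbitMatrix_map_lift (A : Matrix Idx Idx S) (hA : ∀ f ∈ closureEquations A, f = 0) :
    orbitMatrix.map (orbitLift A hA) = A := by
  ext i j
  change MvPolynomial.aeval _ (MvPolynomial.X (i, j)) = _
  rw [MvPolynomial.aeval_X]

theorem orbitMatrix_map_evalAt (A : Matrix Idx Idx ℂ) (hA : A ∈ orbitClosure) :
    orbitMatrix.map (evalAt A hA) = A :=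
  orbitMatrix_map_lift A hA

theorem orbit_algHom_ext {f g : OrbitClosureRing →ₐ[ℂ] S}
    (h : orbitMatrix.map f = orbitMatrix.map g) : f = g := by
  apply Ideal.Quotient.algHom_ext
  ext p : 1
  exact congrFun (congrFun h p.1) p.2

/-- A matrix of determinant one over a `ℂ`-algebra `S` is an `S`-valued point of `SL₂`. -/
def sl2Lift (X : Matrix (Fin 2) (Fin 2) S) (hX : X.det = 1) : SL2Ring →ₐ[ℂ] S :=
  Ideal.Quotient.liftₐ _ (MvPolynomial.aeval fun p => X p.1 p.2) (by
    intro a ha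
    have hle : Ideal.span {(genM (Fin 2)).det - 1} ≤ RingHom.ker
        (MvPolynomial.aeval (R := ℂ) fun p : Fin 2 × Fin 2 => X p.1 p.2).toRingHom := by
      refine Ideal.span_le.mpr ?_
      rintro _ rfl
      have h := RingHom.map_det
        (MvPolynomial.aeval (R := ℂ) fun p : Fin 2 × Fin 2 => X p.1 p.2).toRingHom (genM (Fin 2))
      have e : (genM (Fin 2)).map (MvPolynomial.aeval (R := ℂ)
          fun p : Fin 2 × Fin 2 => X p.1 p.2).toRingHom = X := by
        ext i j; simp [genM]
      rw [RingHom.mapMatrix_apply, e, hX] at h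
      rw [SetLike.mem_coe, RingHom.mem_ker, map_sub, h, map_one, sub_self]
    exact hle ha)

theorem sl2Matrix_map_lift (X : Matrix (Fin 2) (Fin 2) S) (hX : X.det = 1) :
    sl2Matrix.map (sl2Lift X hX) = X := by
  ext i j
  change MvPolynomial.aeval _ (MvPolynomial.X (i, j)) = _
  rw [MvPolynomial.aeval_X]

theorem sl2_algHom_ext {f g : SL2Ring →ₐ[ℂ] S} (h : sl2Matrix.map f = sl2Matrix.map g) :
    f = g := by
  apply Ideal.Quotient.algHom_ext
  ext p : 1
  exact congrFun (congrFun h p.1) p.2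

theorem sl2Matrix_map_action (g : SL(2, ℂ)) :
    sl2Matrix.map (sl2Action g) =
      (g⁻¹ : SL(2, ℂ)).1.map (scalarMap SL2Ring) * sl2Matrix := by
  ext i j
  change Ideal.Quotient.mk _ (polyAction (Fin 2) g (MvPolynomial.X (i, j))) = _
  simp only [polyAction, MonoidHom.coe_mk, OneHom.coe_mk, MvPolynomial.aeval_X, translated,
    Matrix.mul_apply, map_sum, map_mul]
  rfl

theorem zeroFibreMatrix_map_action (g : SL(2, ℂ)) :
    zeroFibreMatrix.map (zeroFibreAction g) =
      (g⁻¹ : SL(2, ℂ)).1.map (scalarMap ZeroFibreRing) * zeroFibreMatrix := by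
  ext i j
  change Ideal.Quotient.mk _ (polyAction Idx g (MvPolynomial.X (i, j))) = _
  simp only [polyAction, MonoidHom.coe_mk, OneHom.coe_mk, MvPolynomial.aeval_X, translated,
    Matrix.mul_apply, map_sum, map_mul]
  rfl

variable (A : Matrix Idx Idx ℂ) (hA : A ∈ orbitClosure)

/-- The restriction of functions to the fibre `ν⁻¹(A)`. -/
def fibreQuotient : ZeroFibreRing →ₐ[ℂ] FibreRing A hA := Ideal.Quotient.mkₐ ℂ (fibreIdeal A hA)

/-- The universal matrix over the fibre `ν⁻¹(A)`. -/
def fibreMatrix : Matrix (Fin 2) Idx (FibreRing A hA) :=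
  zeroFibreMatrix.map (fibreQuotient A hA)

theorem nuMap_fibreMatrix :
    nuMap (fibreMatrix A hA) = A.map (scalarMap (FibreRing A hA)) := by
  have h := nuMap_map (S := FibreRing A hA) (fibreQuotient A hA).toRingHom zeroFibreMatrix
  refine h.trans ?_
  rw [← orbitMatrix_map_nuComorphism]
  ext i j
  -- The functions `a_{ij} - A_{ij}` vanish at `A`, so their pullbacks lie in the ideal of the
  -- fibre.
  have hs : orbitMatrix i j - algebraMap ℂ OrbitClosureRing (A i j) ∈
      RingHom.ker (evalAt A hA).toRingHom := by
    change evalAt A hA (orbitMatrix i j - algebraMap ℂ OrbitClosureRing (A i j)) = 0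
    have e : evalAt A hA (orbitMatrix i j) = A i j :=
      congrFun (congrFun (orbitMatrix_map_evalAt A hA) i) j
    rw [map_sub, AlgHom.commutes, e]
    simp
  have h2 := Ideal.Quotient.eq_zero_iff_mem.mpr
    (Ideal.mem_map_of_mem nuComorphism.toRingHom hs)
  have h3 : fibreQuotient A hA (nuComorphism (orbitMatrix i j -
    algebraMap ℂ OrbitClosureRing (A i j))) = 0 := h2
  rw [map_sub, map_sub, AlgHom.commutes, sub_eq_zero] at h3
  exact h3

variable {A}

/-- A matrix over a `ℂ`-algebra `S` that is mapped to `A` by `ν` is an `S`-valued point of the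
fibre `ν⁻¹(A)`. -/
def fibreLift (M : Matrix (Fin 2) Idx S) (hM : momentMap M = 0)
    (hν : nuMap M = A.map (scalarMap S)) : FibreRing A hA →ₐ[ℂ] S :=
  Ideal.Quotient.liftₐ (fibreIdeal A hA) (zeroFibreLift M hM) (by
    intro a ha
    have hle : fibreIdeal A hA ≤ RingHom.ker (zeroFibreLift M hM).toRingHom := by
      refine Ideal.map_le_iff_le_comap.mpr fun s hs => ?_
      have e : (zeroFibreLift M hM).comp nuComorphism =
          (Algebra.ofId ℂ S).comp (evalAt A hA) := by
        apply orbit_algHom_ext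
        rw [AlgHom.coe_comp, AlgHom.coe_comp, ← Matrix.map_map, ← Matrix.map_map,
          orbitMatrix_map_nuComorphism, orbitMatrix_map_evalAt]
        refine (nuMap_map (zeroFibreLift M hM).toRingHom zeroFibreMatrix).symm.trans ?_
        refine (congrArg nuMap (zeroFibreMatrix_map_lift M hM)).trans ?_
        rw [hν]; rfl
      have hs' : evalAt A hA s = 0 := hs
      change zeroFibreLift M hM (nuComorphism s) = 0
      have := DFunLike.congr_fun e s
      simpa [hs'] using this
    exact hle ha)

theorem fibreMatrix_map_lift (M : Matrix (Fin 2) Idx S) (hM : momentMap M = 0)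
    (hν : nuMap M = A.map (scalarMap S)) :
    (fibreMatrix A hA).map (fibreLift hA M hM hν) = M :=
  zeroFibreMatrix_map_lift M hM

theorem fibre_algHom_ext {f g : FibreRing A hA →ₐ[ℂ] S}
    (h : (fibreMatrix A hA).map f = (fibreMatrix A hA).map g) : f = g := by
  apply Ideal.Quotient.algHom_ext
  exact zeroFibre_algHom_ext h

theorem fibreMatrix_map_action (g : SL(2, ℂ)) :
    (fibreMatrix A hA).map (fibreAction A hA g) =
      (g⁻¹ : SL(2, ℂ)).1.map (scalarMap (FibreRing A hA)) * fibreMatrix A hA := by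
  have h : (fibreMatrix A hA).map (fibreAction A hA g) =
      (zeroFibreMatrix.map (zeroFibreAction g)).map (fibreQuotient A hA).toRingHom := rfl
  rw [h, zeroFibreMatrix_map_action, Matrix.map_mul]
  rfl

end Universal

/-! ### The fibres over the orbit -/

section Fibre

variable {A : Matrix Idx Idx ℂ} (hA : A ∈ orbitClosure)

theorem momentMap_mul_eq_zero {R : Type*} [CommRing R] {G : Matrix (Fin 2) (Fin 2) R}
    (hG : G.det = 1) {M : Matrix (Fin 2) Idx R} (hM : momentMap M = 0) :
    momentMap (G * M) = 0 := by
  rw [momentMap_mul G hG, hM, Matrix.mul_zero, Matrix.zero_mul]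

/-- The fibre over a nonzero point is equivariantly isomorphic to `SL₂`. -/
theorem exists_fibre_equiv (h0 : A ≠ 0) :
    ∃ e : FibreRing A hA ≃ₐ[ℂ] SL2Ring, ∀ (g : SL(2, ℂ)) (f : FibreRing A hA),
      e (fibreAction A hA g f) = sl2Action g (e f) := by
  obtain ⟨i, j, hij⟩ : ∃ i j, coord A i j ≠ 0 := by
    by_contra! h
    exact h0 (ext_coord h)
  have hb : coord A i j * (coord A i j)⁻¹ = 1 := mul_inv_cancel₀ hij
  have hAeq : ∀ f ∈ closureEquations A, f = 0 := hA
  set M₀ := sectionMatrix A i j (coord A i j)⁻¹ with hM₀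
  have hν₀ : nuMap M₀ = A := nuMap_sectionMatrix hAeq hb
  have hμ₀ : momentMap M₀ = 0 := momentMap_sectionMatrix hAeq i j _
  have hμS : ∀ (S : Type) [CommRing S] [Algebra ℂ S], momentMap (M₀.map (scalarMap S)) = 0 := by
    intro S _ _
    rw [momentMap_map, hμ₀]
    ext; simp
  have hνS : ∀ (S : Type) [CommRing S] [Algebra ℂ S],
      nuMap (M₀.map (scalarMap S)) = A.map (scalarMap S) := by
    intro S _ _
    rw [nuMap_map, hν₀]
  have hS : ∀ (S : Type) [CommRing S] [Algebra ℂ S], M₀.map (scalarMap S) =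
      sectionMatrix (A.map (scalarMap S)) i j (scalarMap S (coord A i j)⁻¹) := by
    intro S _ _
    rw [hM₀, sectionMatrix_map]
  have hbS : ∀ (S : Type) [CommRing S] [Algebra ℂ S],
      coord (A.map (scalarMap S)) i j * scalarMap S (coord A i j)⁻¹ = 1 := by
    intro S _ _
    rw [coord_map, ← map_mul, hb, map_one]
  -- Comorphism of the orbit map `X ↦ X M₀` from `SL₂` to the fibre.
  let φ : FibreRing A hA →ₐ[ℂ] SL2Ring :=
    fibreLift hA (sl2Matrix * M₀.map (scalarMap SL2Ring))
      (momentMap_mul_eq_zero det_sl2Matrix (hμS _))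
      (by rw [nuMap_mul _ det_sl2Matrix, hνS])
  have hbF : coord (nuMap (fibreMatrix A hA)) i j *
      scalarMap (FibreRing A hA) (coord A i j)⁻¹ = 1 := by
    rw [nuMap_fibreMatrix, hbS]
  -- Comorphism of the inverse, which sends `M` to the matrix carrying `M₀` to `M`.
  let ψ : SL2Ring →ₐ[ℂ] FibreRing A hA :=
    sl2Lift (transporter (fibreMatrix A hA) i j (scalarMap (FibreRing A hA) (coord A i j)⁻¹))
      (det_transporter _ hbF)
  have hφ : (fibreMatrix A hA).map φ = sl2Matrix * M₀.map (scalarMap SL2Ring) :=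
    fibreMatrix_map_lift hA _ _ _
  have hψ : sl2Matrix.map ψ =
      transporter (fibreMatrix A hA) i j (scalarMap (FibreRing A hA) (coord A i j)⁻¹) :=
    sl2Matrix_map_lift _ _
  have h1 : φ.comp ψ = AlgHom.id ℂ _ := by
    apply sl2_algHom_ext
    rw [AlgHom.coe_comp, ← Matrix.map_map, hψ]
    refine (transporter_map φ.toRingHom (fibreMatrix A hA) i j _).trans ?_
    have e : (fibreMatrix A hA).map φ.toRingHom = _ := hφ
    rw [e, hS]
    have e2 : φ.toRingHom (scalarMap (FibreRing A hA) (coord A i j)⁻¹) =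
      scalarMap SL2Ring (coord A i j)⁻¹ := φ.commutes _
    rw [e2, transporter_mul]
    · ext; simp
    · rw [coord_map, coord_self hAeq, map_zero]
    · rw [coord_map, coord_self hAeq, map_zero]
    · exact hbS _
  have h2 : ψ.comp φ = AlgHom.id ℂ _ := by
    refine fibre_algHom_ext (S := FibreRing A hA) hA ?_
    rw [AlgHom.coe_comp, ← Matrix.map_map, hφ]
    refine (Matrix.map_mul (f := ψ.toRingHom)).trans ?_
    have e : sl2Matrix.map ψ.toRingHom = _ := hψ
    have e2 : (M₀.map (scalarMap SL2Ring)).map ψ.toRingHom =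
        M₀.map (scalarMap (FibreRing A hA)) := by
      ext a b
      exact ψ.commutes _
    rw [e, e2, hS, ← nuMap_fibreMatrix A hA, transporter_mul_sectionMatrix _ hbF]
    ext; simp
  refine ⟨AlgEquiv.ofAlgHom φ ψ h1 h2, fun g f => ?_⟩
  -- Both sides send the universal matrix to `g⁻¹ X M₀`; associativity of the matrix product is the
  -- equivariance.
  have h3 : φ.comp (fibreAction A hA g) = (sl2Action g).comp φ := by
    apply fibre_algHom_ext
    rw [AlgHom.coe_comp, ← Matrix.map_map, fibreMatrix_map_action, AlgHom.coe_comp,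
      ← Matrix.map_map, hφ]
    refine (Matrix.map_mul (f := φ.toRingHom)).trans ?_
    refine Eq.trans ?_ (Matrix.map_mul (f := (sl2Action g).toRingHom)).symm
    have e : (fibreMatrix A hA).map φ.toRingHom = _ := hφ
    have e2 : ((g⁻¹ : SL(2, ℂ)).1.map (scalarMap (FibreRing A hA))).map φ.toRingHom =
        (g⁻¹ : SL(2, ℂ)).1.map (scalarMap SL2Ring) := by
      ext a b
      exact φ.commutes _
    have e3 : (M₀.map (scalarMap SL2Ring)).map (sl2Action g).toRingHom =
        M₀.map (scalarMap SL2Ring) := by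
      ext a b
      exact (sl2Action g).commutes _
    have e4 : sl2Matrix.map (sl2Action g).toRingHom = _ := sl2Matrix_map_action g
    rw [e, e2, e3, e4, Matrix.mul_assoc]
  exact DFunLike.congr_fun h3 f

end Fibre

/-! ### The orbit and its closure -/

theorem exists_injective_of_isotropic : ∀ i j : Idx, j ≠ i → j ≠ i.swap →
    ∃ k : Idx, Function.Injective
      (Sum.elim ![i, j, k] (fun a => (![i, j, k] a).swap) : Idx → Idx) := by
  decide +kernel

/-- Two coordinates that do not pair under `Q` are the first two coordinates up to an even
permutation of the coordinates that preserves `Q`. -/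
theorem exists_perm_of_isotropic {i j : Idx} (h₁ : j ≠ i) (h₂ : j ≠ i.swap) :
    ∃ σ : Equiv.Perm Idx, (∀ s, σ s.swap = (σ s).swap) ∧ σ (Sum.inl 0) = i ∧
      σ (Sum.inl 1) = j ∧ Equiv.Perm.sign σ = 1 := by
  obtain ⟨k, hk⟩ := exists_injective_of_isotropic i j h₁ h₂
  let σ : Equiv.Perm Idx := Equiv.ofBijective _ (Finite.injective_iff_bijective.mp hk)
  have hσ : ∀ s, σ s.swap = (σ s).swap := by
    rintro (s | s)
    · rfl
    · exact (Sum.swap_swap _).symm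
  rcases Int.units_eq_one_or (Equiv.Perm.sign σ) with hs | hs
  · exact ⟨σ, hσ, rfl, rfl, hs⟩
  -- Exchanging the last hyperbolic pair corrects the sign without moving the first two coordinates.
  · let τ : Equiv.Perm Idx := Equiv.swap (Sum.inl 2) (Sum.inr 2)
    have hτ : ∀ s, τ s.swap = (τ s).swap := by decide
    refine ⟨σ * τ, fun s => ?_, rfl, rfl, ?_⟩
    · rw [Equiv.Perm.mul_apply, Equiv.Perm.mul_apply, hτ, hσ]
    · rw [map_mul, hs, Equiv.Perm.sign_swap (by decide)]
      rfl

theorem sum_perm {R : Type*} [AddCommMonoid R] (σ : Equiv.Perm Idx) (f : Idx → R) :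
    ∑ k, f k = f (σ (Sum.inl 0)) + f (σ (Sum.inl 1)) + f (σ (Sum.inl 2)) +
      (f (σ (Sum.inr 0)) + f (σ (Sum.inr 1)) + f (σ (Sum.inr 2))) := by
  rw [← Equiv.sum_comp σ, Fintype.sum_sum_type, Fin.sum_univ_three, Fin.sum_univ_three]

theorem momentMap_perm {R : Type*} [CommRing R] {σ : Equiv.Perm Idx}
    (hσ : ∀ s, σ s.swap = (σ s).swap) {M : Matrix (Fin 2) Idx R} (hM : momentMap M = 0)
    (a b : Fin 2) :
    M a (σ (.inl 0)) * M b (σ (.inr 0)) + M a (σ (.inl 1)) * M b (σ (.inr 1)) +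
      M a (σ (.inl 2)) * M b (σ (.inr 2)) + (M a (σ (.inr 0)) * M b (σ (.inl 0)) +
      M a (σ (.inr 1)) * M b (σ (.inl 1)) + M a (σ (.inr 2)) * M b (σ (.inl 2))) = 0 := by
  have h := (momentMap_eq_zero_iff M).mp hM a b
  rw [sum_perm σ] at h
  simpa only [← hσ, Sum.swap_inl, Sum.swap_inr] using h

/-- The isotropy relation for rows `i` and `i.swap` expresses the square of `c_{i, i.swap}` through
products with a factor `c_{ik}`, where `k ≠ i.swap`. If all of these lie in the prime `I`, so does
`c_{i, i.swap}`. -/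
theorem exists_isotropic_coord_notMem {R : Type*} [CommRing R] [Algebra ℂ R]
    {A : Matrix Idx Idx R} (hA : ∀ f ∈ closureEquations A, f = 0) (I : Ideal R) [hI : I.IsPrime]
    (h : ∃ i j, coord A i j ∉ I) :
    ∃ i j, j ≠ i ∧ j ≠ i.swap ∧ coord A i j ∉ I := by
  by_contra! H
  obtain ⟨i, j, hij⟩ := h
  have hji : j ≠ i := by
    rintro rfl
    exact hij (by rw [coord_self hA]; exact I.zero_mem)
  obtain rfl : j = i.swap := by
    by_contra hj
    exact hij (H i j hji hj)
  have hs := coord_isotropic hA i i.swap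
  rw [← Finset.add_sum_erase _ _ (Finset.mem_univ i.swap), Sum.swap_swap, coord_skew hA i.swap i,
    mul_neg, neg_add_eq_zero] at hs
  have hm : coord A i i.swap * coord A i i.swap ∈ I := by
    rw [hs]
    refine Ideal.sum_mem _ fun k hk => Ideal.mul_mem_right _ _ ?_
    rw [Finset.mem_erase] at hk
    by_cases hki : k = i
    · rw [hki, coord_self hA]
      exact I.zero_mem
    · exact H i k hki hk.1
  exact hij ((hI.mem_or_mem hm).elim id id)

/-- The matrix whose rows are the first two basis vectors. -/
def baseRows : Matrix (Fin 2) Idx ℂ := Matrix.of ![Pi.single (Sum.inl 0) 1, Pi.single (Sum.inl 1) 1]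

theorem nuMap_baseRows : nuMap baseRows = basePoint := by
  ext k l
  rw [nuMap_apply]
  rcases k with k | k <;> rcases l with l | l <;> fin_cases k <;> fin_cases l <;>
    simp [baseRows, basePoint]

theorem baseRows_mul_transpose (g : Matrix Idx Idx ℂ) :
    baseRows * g.transpose = Matrix.of ![fun k => g k (Sum.inl 0), fun k => g k (Sum.inl 1)] := by
  ext a k
  fin_cases a <;> simp [baseRows, Matrix.mul_apply, Pi.single_apply]

/-- An isometry has inverse `Q gᵗ Q`, so `ν` turns right multiplication by `gᵗ` into conjugation by
`g`. The rows on the right are the first two columns of `g`. -/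
theorem conj_basePoint {g : Matrix Idx Idx ℂ} (hg : g.transpose * formQ ℂ * g = formQ ℂ) :
    g * basePoint * g⁻¹ = nuMap (baseRows * g.transpose) := by
  have hinv : g⁻¹ = formQ ℂ * g.transpose * formQ ℂ := by
    refine Matrix.inv_eq_left_inv ?_
    rw [Matrix.mul_assoc, Matrix.mul_assoc, ← Matrix.mul_assoc g.transpose, hg, formQ_mul_formQ]
  rw [hinv, ← nuMap_baseRows, nuMap, nuMap, Matrix.transpose_mul, Matrix.transpose_transpose]
  have : g * (baseRows.transpose * formJ ℂ * baseRows * formQ ℂ) *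
      (formQ ℂ * g.transpose * formQ ℂ) = g * baseRows.transpose * formJ ℂ * baseRows *
      (formQ ℂ * formQ ℂ) * g.transpose * formQ ℂ := by
    simp only [Matrix.mul_assoc]
  rw [this, formQ_mul_formQ, Matrix.mul_one]
  simp only [Matrix.mul_assoc]

theorem momentMap_baseRows_mul {g : Matrix Idx Idx ℂ}
    (hg : g.transpose * formQ ℂ * g = formQ ℂ) : momentMap (baseRows * g.transpose) = 0 := by
  have : momentMap (baseRows * g.transpose) =
      baseRows * (g.transpose * formQ ℂ * g) * baseRows.transpose * formJ ℂ := by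
    simp only [momentMap, Matrix.transpose_mul, Matrix.transpose_transpose, Matrix.mul_assoc]
  rw [this, hg]
  change momentMap baseRows = 0
  rw [momentMap_eq_zero_iff]
  intro a b
  fin_cases a <;> fin_cases b <;> simp [baseRows, Pi.single_apply]

theorem nilpotentOrbit_subset : nilpotentOrbit ⊆ orbitClosure := by
  rintro A ⟨g, hg, -, rfl⟩
  rw [conj_basePoint hg]
  exact closureEquations_nuMap _ (momentMap_baseRows_mul hg)

theorem zero_mem_orbitClosure : (0 : Matrix Idx Idx ℂ) ∈ orbitClosure := by
  have h : nuMap (0 : Matrix (Fin 2) Idx ℂ) = 0 := by simp [nuMap]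
  have h' := closureEquations_nuMap (0 : Matrix (Fin 2) Idx ℂ) (by simp [momentMap])
  rwa [h] at h'

theorem zero_notMem_nilpotentOrbit : (0 : Matrix Idx Idx ℂ) ∉ nilpotentOrbit := by
  rintro ⟨g, -, hdet, h⟩
  have hu : IsUnit g.det := by rw [hdet]; exact isUnit_one
  have h0 : basePoint = 0 := by
    have : g⁻¹ * (g * basePoint * g⁻¹) * g = basePoint := by
      rw [Matrix.mul_assoc, Matrix.mul_assoc g, Matrix.mul_assoc g, Matrix.mul_assoc basePoint,
        Matrix.nonsing_inv_mul _ hu, Matrix.mul_one, ← Matrix.mul_assoc,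
        Matrix.nonsing_inv_mul _ hu, Matrix.one_mul]
    rw [← this, ← h]
    simp
  have h1 := congrFun (congrFun h0 (Sum.inl 0)) (Sum.inr 1)
  simp [basePoint] at h1

/-- The matrix of an isometry of `Q` whose first two columns are `p` and `q`, where the first two
entries of `p` are `1, 0` and those of `q` are `0, b`. -/
def isometryMatrix (b : ℂ) (p q : Idx → ℂ) : Matrix Idx Idx ℂ :=
  Matrix.fromBlocks !![1, 0, 0; 0, b, 0; p (.inl 2), q (.inl 2), 1] 0
    !![p (.inr 0), q (.inr 0), -p (.inr 2); p (.inr 1), q (.inr 1), -b⁻¹ * q (.inr 2);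
      p (.inr 2), q (.inr 2), 0]
    !![1, 0, -p (.inl 2); 0, b⁻¹, -b⁻¹ * q (.inl 2); 0, 0, 1]

/-- The matrix is block triangular with triangular diagonal blocks, of determinants `b` and `b⁻¹`.
-/
theorem det_isometryMatrix {b : ℂ} (hb : b ≠ 0) (p q : Idx → ℂ) :
    (isometryMatrix b p q).det = 1 := by
  rw [isometryMatrix, Matrix.det_fromBlocks_zero₁₂, Matrix.det_fin_three, Matrix.det_fin_three]
  simp [hb]

/-- The remaining columns are basis vectors rescaled and corrected to have the right pairings with
`p` and `q`. The only relations still needed are the three isotropy conditions on `p` and `q`. -/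
theorem isometryMatrix_gram {b : ℂ} (hb : b ≠ 0) {p q : Idx → ℂ}
    (hpp : p (.inr 0) + p (.inl 2) * p (.inr 2) = 0)
    (hqq : b * q (.inr 1) + q (.inl 2) * q (.inr 2) = 0)
    (hpq : q (.inr 0) + b * p (.inr 1) + p (.inl 2) * q (.inr 2) + p (.inr 2) * q (.inl 2) = 0)
    (x y : Idx) :
    ∑ r, isometryMatrix b p q r x * isometryMatrix b p q r.swap y = formQ ℂ x y := by
  have hb' : b * b⁻¹ = 1 := mul_inv_cancel₀ hb
  rw [Fintype.sum_sum_type, Fin.sum_univ_three, Fin.sum_univ_three]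
  rcases x with x | x <;> rcases y with y | y <;> fin_cases x <;> fin_cases y <;>
    simp [isometryMatrix, formQ, hb]
  · linear_combination 2 * hpp
  · linear_combination hpq
  · linear_combination hpq
  · linear_combination 2 * hqq
  · linear_combination -q (.inr 2) * hb'
  · linear_combination -q (.inl 2) * hb'

theorem mem_nilpotentOrbit {A : Matrix Idx Idx ℂ} (hA : A ∈ orbitClosure) (h0 : A ≠ 0) :
    A ∈ nilpotentOrbit := by
  have hAeq : ∀ f ∈ closureEquations A, f = 0 := hA
  obtain ⟨i, j, h₁, h₂, hij⟩ := exists_isotropic_coord_notMem hAeq ⊥ (by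
    by_contra! h
    exact h0 (ext_coord h))
  have hb0 : coord A i j ≠ 0 := hij
  obtain ⟨σ, hσ, rfl, rfl, hsign⟩ := exists_perm_of_isotropic h₁ h₂
  set b := coord A (σ (.inl 0)) (σ (.inl 1)) with hb
  set M := sectionMatrix A (σ (.inl 0)) (σ (.inl 1)) b⁻¹ with hM
  have hν : nuMap M = A := nuMap_sectionMatrix hAeq (mul_inv_cancel₀ hb0)
  have hμ : momentMap M = 0 := momentMap_sectionMatrix hAeq _ _ _
  let p : Idx → ℂ := fun s => M 0 (σ s)
  let q : Idx → ℂ := fun s => M 1 (σ s)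
  have hp0 : p (.inl 0) = 1 := mul_inv_cancel₀ hb0
  have hp1 : p (.inl 1) = 0 := by
    simp only [p, hM, sectionMatrix_zero, coord_self hAeq, zero_mul]
  have hq0 : q (.inl 0) = 0 := coord_self hAeq _
  have hq1 : q (.inl 1) = b := rfl
  have e00 : p (.inl 0) * p (.inr 0) + p (.inl 1) * p (.inr 1) + p (.inl 2) * p (.inr 2) +
      (p (.inr 0) * p (.inl 0) + p (.inr 1) * p (.inl 1) + p (.inr 2) * p (.inl 2)) = 0 :=
    momentMap_perm hσ hμ 0 0
  have e01 : p (.inl 0) * q (.inr 0) + p (.inl 1) * q (.inr 1) + p (.inl 2) * q (.inr 2) +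
      (p (.inr 0) * q (.inl 0) + p (.inr 1) * q (.inl 1) + p (.inr 2) * q (.inl 2)) = 0 :=
    momentMap_perm hσ hμ 0 1
  have e11 : q (.inl 0) * q (.inr 0) + q (.inl 1) * q (.inr 1) + q (.inl 2) * q (.inr 2) +
      (q (.inr 0) * q (.inl 0) + q (.inr 1) * q (.inl 1) + q (.inr 2) * q (.inl 2)) = 0 :=
    momentMap_perm hσ hμ 1 1
  rw [hp0, hp1] at e00 e01
  rw [hq0, hq1] at e01 e11
  have hgram := isometryMatrix_gram (p := p) (q := q) hb0 (by linear_combination e00 / 2)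
    (by linear_combination e11 / 2) (by linear_combination e01)
  -- Undo the permutation on the rows only. It preserves `Q` and is even, so `g` stays in `SO₆`.
  let g : Matrix Idx Idx ℂ := (isometryMatrix b p q).submatrix σ.symm id
  have hg : g.transpose * formQ ℂ * g = formQ ℂ := by
    ext x y
    rw [← hgram x y, Matrix.mul_apply, ← Equiv.sum_comp σ,
      ← (Equiv.sumComm (Fin 3) (Fin 3)).sum_comp]
    refine Finset.sum_congr rfl fun r _ => ?_
    rw [mul_formQ_apply]
    simp only [g, Equiv.sumComm_apply, ← hσ, Matrix.transpose_apply, Matrix.submatrix_apply,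
      Equiv.symm_apply_apply, id_eq, Sum.swap_swap]
  have hrows : baseRows * g.transpose = M := by
    rw [baseRows_mul_transpose]
    ext a k
    obtain ⟨s, rfl⟩ := σ.surjective k
    fin_cases a
    · change isometryMatrix b p q (σ.symm (σ s)) (.inl 0) = p s
      rw [Equiv.symm_apply_apply]
      rcases s with s | s <;> fin_cases s <;> simp [isometryMatrix, hp0, hp1]
    · change isometryMatrix b p q (σ.symm (σ s)) (.inl 1) = q s
      rw [Equiv.symm_apply_apply]
      rcases s with s | s <;> fin_cases s <;> simp [isometryMatrix, hq0, hq1]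
  refine ⟨g, hg, ?_, ?_⟩
  · rw [Matrix.det_permute, det_isometryMatrix hb0, Equiv.Perm.sign_symm, hsign]
    simp
  · rw [conj_basePoint hg, hrows, hν]

theorem mem_nilpotentOrbit_iff {A : Matrix Idx Idx ℂ} (hA : A ∈ orbitClosure) :
    A ∈ nilpotentOrbit ↔ A ≠ 0 :=
  ⟨fun h h0 => zero_notMem_nilpotentOrbit (h0 ▸ h), mem_nilpotentOrbit hA⟩

theorem orbitClosure_eq : orbitClosure = nilpotentOrbit ∪ {0} := by
  ext A
  refine ⟨fun hA => ?_, ?_⟩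
  · by_cases h0 : A = 0
    · exact Or.inr h0
    · exact Or.inl (mem_nilpotentOrbit hA h0)
  · rintro (h | rfl)
    · exact nilpotentOrbit_subset h
    · exact zero_mem_orbitClosure

/-! ### Flatness over the orbit -/

section Flat

open TensorProduct

theorem map_nuMap {R S : Type*} [CommRing R] [CommRing S] [Algebra ℂ R] [Algebra ℂ S]
    (φ : R →ₐ[ℂ] S) (M : Matrix (Fin 2) Idx R) : nuMap (M.map φ) = (nuMap M).map φ :=
  nuMap_map φ.toRingHom M

theorem map_momentMap {R S : Type*} [CommRing R] [CommRing S] [Algebra ℂ R] [Algebra ℂ S]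
    (φ : R →ₐ[ℂ] S) {M : Matrix (Fin 2) Idx R} (hM : momentMap M = 0) :
    momentMap (M.map φ) = 0 := by
  refine (momentMap_map φ.toRingHom M).trans ?_
  rw [hM]
  ext; simp

theorem map_matrix_mul {R S κ : Type*} [CommRing R] [CommRing S] [Algebra ℂ R] [Algebra ℂ S]
    (φ : R →ₐ[ℂ] S) (X : Matrix (Fin 2) (Fin 2) R) (M : Matrix (Fin 2) κ R) :
    (X * M).map φ = X.map φ * M.map φ :=
  Matrix.map_mul (f := φ.toRingHom)

theorem map_det_eq_one {R S : Type*} [CommRing R] [CommRing S] [Algebra ℂ R] [Algebra ℂ S]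
    (φ : R →ₐ[ℂ] S) {X : Matrix (Fin 2) (Fin 2) R} (hX : X.det = 1) : (X.map φ).det = 1 := by
  refine (RingHom.map_det φ.toRingHom X).symm.trans ?_
  rw [hX, map_one]

theorem closureEquations_map_orbitMatrix {S : Type*} [CommRing S] [Algebra ℂ S]
    (φ : OrbitClosureRing →ₐ[ℂ] S) : ∀ f ∈ closureEquations (orbitMatrix.map φ), f = 0 := by
  intro f hf
  obtain ⟨f, hf', rfl⟩ := closureEquations_map_subset φ.toRingHom orbitMatrix hf
  rw [closureEquations_orbitMatrix f hf', map_zero]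

/-- The coproduct of two `ℂ`-algebras exists and is flat over both of them. -/
theorem exists_flat_coproduct (A B : Type) [CommRing A] [CommRing B] [Algebra ℂ A]
    [Algebra ℂ B] : ∃ (P : Type) (_ : CommRing P) (_ : Algebra ℂ P) (inl : A →ₐ[ℂ] P)
      (inr : B →ₐ[ℂ] P), inl.toRingHom.Flat ∧
      (∀ (S : Type) [CommRing S] [Algebra ℂ S] (β : A →ₐ[ℂ] S) (ψ : B →ₐ[ℂ] S),
        ∃ e : P →ₐ[ℂ] S, e.comp inl = β ∧ e.comp inr = ψ) ∧
      ∀ f g : P →ₐ[ℂ] P, f.comp inl = g.comp inl → f.comp inr = g.comp inr → f = g := by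
  refine ⟨A ⊗[ℂ] B, inferInstance, inferInstance, Algebra.TensorProduct.includeLeft,
    Algebra.TensorProduct.includeRight, ?_, fun S _ _ β ψ => ?_, fun f g h h' => ?_⟩
  -- Base change of `B`, which is flat over the field `ℂ`.
  · exact (RingHom.flat_algebraMap_iff (R := A) (S := A ⊗[ℂ] B)).mpr inferInstance
  · exact ⟨Algebra.TensorProduct.productMap β ψ, Algebra.TensorProduct.productMap_left β ψ,
      Algebra.TensorProduct.productMap_right β ψ⟩
  · refine Algebra.TensorProduct.ext' fun a b => ?_
    have e : a ⊗ₜ[ℂ] b = a ⊗ₜ[ℂ] (1 : B) * (1 : A) ⊗ₜ[ℂ] b := by simp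
    rw [e, map_mul, map_mul]
    exact congrArg₂ (· * ·) (DFunLike.congr_fun h a) (DFunLike.congr_fun h' b)

/-- Over an open set on which a coordinate is invertible, `ν` is a trivial `SL₂`-bundle: the ring
`Tb` of functions over `Rb` is the coproduct `P` of `Rb` and the coordinate ring of `SL₂`. -/
theorem exists_equiv_of_coord_isUnit {Rb Tb P : Type} [CommRing Rb] [CommRing Tb] [CommRing P]
    [Algebra ℂ Rb] [Algebra ℂ Tb] [Algebra ℂ P] (ι : OrbitClosureRing →ₐ[ℂ] Rb)
    (κ : ZeroFibreRing →ₐ[ℂ] Tb) (β : Rb →ₐ[ℂ] Tb) (hβ : β.comp ι = κ.comp nuComorphism)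
    {i j : Idx} {b' : Rb} (hb : ι (coord orbitMatrix i j) * b' = 1)
    (hι : ∀ f g : Rb →ₐ[ℂ] P, f.comp ι = g.comp ι → f = g)
    (hκ : ∀ f g : Tb →ₐ[ℂ] Tb, f.comp κ = g.comp κ → f = g)
    (hlift : ∀ φ : ZeroFibreRing →ₐ[ℂ] P, IsUnit (φ (nuComorphism (coord orbitMatrix i j))) →
      ∃ φ' : Tb →ₐ[ℂ] P, φ'.comp κ = φ)
    (inl : Rb →ₐ[ℂ] P) (inr : SL2Ring →ₐ[ℂ] P)
    (hprod : ∀ ψ : SL2Ring →ₐ[ℂ] Tb, ∃ e : P →ₐ[ℂ] Tb, e.comp inl = β ∧ e.comp inr = ψ)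
    (hext : ∀ f g : P →ₐ[ℂ] P, f.comp inl = g.comp inl → f.comp inr = g.comp inr → f = g) :
    ∃ e : P ≃ₐ[ℂ] Tb, (e : P →ₐ[ℂ] Tb).comp inl = β := by
  let A : Matrix Idx Idx Rb := orbitMatrix.map ι
  have hA : ∀ f ∈ closureEquations A, f = 0 := closureEquations_map_orbitMatrix ι
  have hbA : coord A i j * b' = 1 := hb
  let M₀ : Matrix (Fin 2) Idx Rb := sectionMatrix A i j b'
  have hν₀ : nuMap M₀ = A := nuMap_sectionMatrix hA hbA
  have hμ₀ : momentMap M₀ = 0 := momentMap_sectionMatrix hA i j b'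
  have hX : (sl2Matrix.map inr).det = 1 := map_det_eq_one inr det_sl2Matrix
  -- The universal product `X M₀` of a point of `SL₂` with the section.
  let MP : Matrix (Fin 2) Idx P := sl2Matrix.map inr * M₀.map inl
  have hMP : momentMap MP = 0 := momentMap_mul_eq_zero hX (map_momentMap inl hμ₀)
  have hνP : nuMap MP = A.map inl := by
    rw [nuMap_mul _ hX, map_nuMap, hν₀]
  let φ : ZeroFibreRing →ₐ[ℂ] P := zeroFibreLift MP hMP
  have hφM : zeroFibreMatrix.map φ = MP := zeroFibreMatrix_map_lift MP hMP
  have hφν : φ.comp nuComorphism = inl.comp ι := by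
    apply orbit_algHom_ext
    rw [AlgHom.coe_comp, AlgHom.coe_comp, ← Matrix.map_map, ← Matrix.map_map,
      orbitMatrix_map_nuComorphism, ← map_nuMap, hφM, hνP]
  -- Since `φ` lies over `ι`, it makes `c_{ij}` invertible and so extends to `Tb`.
  obtain ⟨φ', hφ'⟩ := hlift φ (by
    have h : φ (nuComorphism (coord orbitMatrix i j)) = inl (ι (coord orbitMatrix i j)) :=
      DFunLike.congr_fun hφν _
    rw [h]
    exact (IsUnit.of_mul_eq_one _ hb).map inl)
  have hφ'β : φ'.comp β = inl := by
    apply hι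
    rw [AlgHom.comp_assoc, hβ, ← AlgHom.comp_assoc, hφ', hφν]
  let MT : Matrix (Fin 2) Idx Tb := zeroFibreMatrix.map κ
  have hνT : nuMap MT = A.map β := by
    have h : MT = zeroFibreMatrix.map κ := rfl
    rw [h, map_nuMap, ← orbitMatrix_map_nuComorphism, Matrix.map_map, ← AlgHom.coe_comp, ← hβ,
      AlgHom.coe_comp, ← Matrix.map_map]
  have hbT : coord (nuMap MT) i j * β b' = 1 := by
    rw [hνT, coord_map, ← map_mul, hbA, map_one]
  let ψ : SL2Ring →ₐ[ℂ] Tb := sl2Lift (transporter MT i j (β b')) (det_transporter MT hbT)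
  have hψ : sl2Matrix.map ψ = transporter MT i j (β b') := sl2Matrix_map_lift _ _
  obtain ⟨e, hel, her⟩ := hprod ψ
  have h1 : e.comp φ' = AlgHom.id ℂ Tb := by
    apply hκ
    rw [AlgHom.comp_assoc, hφ']
    apply zeroFibre_algHom_ext
    rw [AlgHom.coe_comp, ← Matrix.map_map, hφM]
    refine (map_matrix_mul e _ _).trans ?_
    rw [Matrix.map_map, Matrix.map_map, ← AlgHom.coe_comp, ← AlgHom.coe_comp, her, hel, hψ]
    have h : M₀.map β = sectionMatrix (nuMap MT) i j (β b') := by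
      rw [hνT]
      exact sectionMatrix_map β.toRingHom A i j b'
    rw [h, transporter_mul_sectionMatrix _ hbT]
    rfl
  have h2 : φ'.comp e = AlgHom.id ℂ _ := by
    apply hext
    · rw [AlgHom.comp_assoc, hel, hφ'β, AlgHom.id_comp]
    · rw [AlgHom.comp_assoc, her, AlgHom.id_comp]
      apply sl2_algHom_ext
      rw [AlgHom.coe_comp, ← Matrix.map_map, hψ]
      refine (transporter_map φ'.toRingHom MT i j (β b')).trans ?_
      have h3 : MT.map φ'.toRingHom = MP := by
        rw [← hφM, ← hφ']
        exact Matrix.map_map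
      have h4 : φ'.toRingHom (β b') = inl b' := DFunLike.congr_fun hφ'β b'
      have h5 : M₀.map inl = sectionMatrix (A.map inl) i j (inl b') :=
        sectionMatrix_map inl.toRingHom A i j b'
      rw [h3, h4]
      change transporter (sl2Matrix.map inr * M₀.map inl) i j (inl b') = _
      rw [h5]
      refine transporter_mul _ ?_ ?_ ?_
      · rw [coord_map, coord_self hA, map_zero]
      · rw [coord_map, coord_self hA, map_zero]
      · rw [coord_map, ← map_mul, hbA, map_one]
  exact ⟨AlgEquiv.ofAlgHom e φ' h1 h2, hel⟩

/-- The localizations enter only through `hι`, `hκ` and `hlift`: the maps `ι` and `κ` are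
epimorphisms, and homomorphisms that invert the coordinate extend to `Tb`. -/
theorem flat_of_coord_isUnit {Rb Tb : Type} [CommRing Rb] [CommRing Tb] [Algebra ℂ Rb]
    [Algebra ℂ Tb] (ι : OrbitClosureRing →ₐ[ℂ] Rb) (κ : ZeroFibreRing →ₐ[ℂ] Tb) (β : Rb →ₐ[ℂ] Tb)
    (hβ : β.comp ι = κ.comp nuComorphism) {i j : Idx} {b' : Rb}
    (hb : ι (coord orbitMatrix i j) * b' = 1)
    (hι : ∀ (P : Type) [CommRing P] [Algebra ℂ P] (f g : Rb →ₐ[ℂ] P),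
      f.comp ι = g.comp ι → f = g)
    (hκ : ∀ (P : Type) [CommRing P] [Algebra ℂ P] (f g : Tb →ₐ[ℂ] P),
      f.comp κ = g.comp κ → f = g)
    (hlift : ∀ (P : Type) [CommRing P] [Algebra ℂ P] (φ : ZeroFibreRing →ₐ[ℂ] P),
      IsUnit (φ (nuComorphism (coord orbitMatrix i j))) → ∃ φ' : Tb →ₐ[ℂ] P, φ'.comp κ = φ) :
    β.toRingHom.Flat := by
  obtain ⟨P, _, _, inl, inr, hinl, hprod, hext⟩ := exists_flat_coproduct Rb SL2Ring
  obtain ⟨e, he⟩ := exists_equiv_of_coord_isUnit ι κ β hβ hb (hι _) (hκ _) (hlift _) inl inr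
    (hprod Tb β) hext
  have hcomp : β.toRingHom = (e : P →+* Tb).comp inl.toRingHom := by
    rw [← he]; rfl
  rw [hcomp]
  exact hinl.comp (.of_bijective e.bijective)

theorem flat_awayMap (i j : Idx) :
    RingHom.Flat (R := Localization.Away (coord orbitMatrix i j))
      (S := Localization.Away (nuComorphism (coord orbitMatrix i j)))
      (Localization.awayMap nuComorphism.toRingHom (coord orbitMatrix i j)) := by
  set b : OrbitClosureRing := coord orbitMatrix i j with hb
  refine flat_of_coord_isUnit (IsScalarTower.toAlgHom ℂ OrbitClosureRing (Localization.Away b))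
    (IsScalarTower.toAlgHom ℂ ZeroFibreRing (Localization.Away (nuComorphism b)))
    (Localization.awayMapₐ nuComorphism b) (b' := IsLocalization.Away.invSelf b) (i := i) (j := j)
    ?_ ?_ ?_ ?_ ?_
  · ext1 x
    simp [IsLocalization.Away.mapₐ, IsLocalization.Away.map]
  · exact IsLocalization.Away.mul_invSelf b
  · intro P _ _ f g h
    apply AlgHom.coe_ringHom_injective
    apply IsLocalization.ringHom_ext (Submonoid.powers b)
    exact congrArg AlgHom.toRingHom h
  · intro P _ _ f g h
    apply AlgHom.coe_ringHom_injective
    apply IsLocalization.ringHom_ext (Submonoid.powers (nuComorphism b))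
    exact congrArg AlgHom.toRingHom h
  · intro P _ _ φ hφ
    refine ⟨IsLocalization.Away.liftAlgHom (nuComorphism b) hφ, ?_⟩
    ext1 x
    simp

end Flat

/-- A morphism of affine schemes restricted to an open subset `U` of the target is flat if `U` is
covered by basic open sets over which the localized ring homomorphism is flat. -/
theorem flat_morphismRestrict_of_basicOpen {R S : CommRingCat} (f : R ⟶ S) (U : (Spec R).Opens)
    (H : ∀ x ∈ U, ∃ r : R, x ∈ PrimeSpectrum.basicOpen r ∧ PrimeSpectrum.basicOpen r ≤ U ∧
      (Localization.awayMap f.hom r).Flat) : Flat (Spec.map f ∣_ U) := by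
  have hlocal : IsZariskiLocalAtTarget @Flat :=
    HasRingHomProperty.instIsZariskiLocalAtTarget (P := @Flat) (Q := RingHom.Flat)
  have hiso : MorphismProperty.RespectsIso @Flat := hlocal.toRespects
  refine IsZariskiLocalAtTarget.of_forall_exists_morphismRestrict fun x => ?_
  obtain ⟨r, hx, hr, hflat⟩ := H x.1 x.2
  let D : (Spec R).Opens := PrimeSpectrum.basicOpen r
  have hD : U.ι ''ᵁ (U.ι ⁻¹ᵁ D) = D := by
    rw [Scheme.Hom.image_preimage_eq_opensRange_inf, Scheme.Opens.opensRange_ι]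
    exact inf_eq_right.mpr hr
  refine ⟨U.ι ⁻¹ᵁ D, hx, ?_⟩
  -- Restricting to `U` and then to `D ≤ U` is restricting to `D`, where the morphism is the
  -- spectrum of the localized homomorphism.
  rw [MorphismProperty.arrow_mk_iso_iff (P := @Flat)
    (morphismRestrictRestrict _ _ _ ≪≫ morphismRestrictEq _ hD ≪≫ SpecMapRestrictBasicOpenIso f r)]
  exact Flat.SpecMap_iff.mpr hflat

/-! ### The orbit as an open subscheme -/

section Chart

open MvPolynomial

/-- The parametrization of the chart of `μ⁻¹(0)` given by the first two columns, in which the first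
row is `(1, 0, x₁, …)` and the second row is `t (0, 1, x₄, …)`, where `t = x₀`. -/
def chartMatrix : Matrix (Fin 2) Idx (MvPolynomial (Fin 6) ℂ) :=
  Matrix.of ![Sum.elim ![1, 0, X 1] ![-(X 1 * X 2), X 3, X 2],
    Sum.elim ![0, X 0, X 0 * X 4]
      ![-(X 0 * (X 3 + X 1 * X 5 + X 2 * X 4)), -(X 0 * (X 4 * X 5)), X 0 * X 5]]

/-- The three isotropy equations are linear in the entries `p(inr 0)`, `q(inr 0)`, `q(inr 1)`, which
are solved for; the other entries are free. -/
theorem momentMap_chartMatrix {σ : Equiv.Perm Idx} (hσ : ∀ s, σ s.swap = (σ s).swap) :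
    momentMap (chartMatrix.submatrix id σ.symm) = 0 := by
  rw [momentMap_eq_zero_iff]
  intro a b
  rw [sum_perm σ]
  simp only [← hσ, Sum.swap_inl, Sum.swap_inr, Matrix.submatrix_apply, Equiv.symm_apply_apply,
    id_eq]
  fin_cases a <;> fin_cases b <;> simp [chartMatrix] <;> ring

/-- Nilpotent functions on the orbit closure vanish where an isotropic coordinate is nonzero. -/
theorem exists_pow_mul_eq_zero_of_isNilpotent {i j : Idx} (h₁ : j ≠ i) (h₂ : j ≠ i.swap)
    {f : OrbitClosureRing} (hf : IsNilpotent f) : ∃ n : ℕ, coord orbitMatrix i j ^ n * f = 0 := by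
  obtain ⟨σ, hσ, rfl, rfl, -⟩ := exists_perm_of_isotropic h₁ h₂
  set b : OrbitClosureRing := coord orbitMatrix (σ (.inl 0)) (σ (.inl 1)) with hb
  -- The localization map will factor as `ψ ∘ θ` through this domain, where nilpotents vanish.
  let θ : OrbitClosureRing →ₐ[ℂ] MvPolynomial (Fin 6) ℂ :=
    orbitLift (nuMap (chartMatrix.submatrix id σ.symm))
      (closureEquations_nuMap _ (momentMap_chartMatrix hσ))
  have hθ : orbitMatrix.map θ = nuMap (chartMatrix.submatrix id σ.symm) :=
    orbitMatrix_map_lift _ _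
  let ι : OrbitClosureRing →ₐ[ℂ] Localization.Away b :=
    IsScalarTower.toAlgHom ℂ OrbitClosureRing (Localization.Away b)
  let b' : Localization.Away b := IsLocalization.Away.invSelf b
  have hb' : ι b * b' = 1 := IsLocalization.Away.mul_invSelf b
  let A : Matrix Idx Idx (Localization.Away b) := orbitMatrix.map ι
  have hA : ∀ f ∈ closureEquations A, f = 0 := closureEquations_map_orbitMatrix ι
  let M := sectionMatrix A (σ (.inl 0)) (σ (.inl 1)) b'
  have hν : nuMap M = A := nuMap_sectionMatrix hA hb'
  have hμ : momentMap M = 0 := momentMap_sectionMatrix hA _ _ _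
  have hp0 : M 0 (σ (.inl 0)) = 1 := hb'
  have hp1 : M 0 (σ (.inl 1)) = 0 := by
    simp only [M, sectionMatrix_zero, coord_self hA, zero_mul]
  have hq0 : M 1 (σ (.inl 0)) = 0 := coord_self hA _
  have hq1 : M 1 (σ (.inl 1)) = ι b := rfl
  have e00 :=
    momentMap_perm hσ hμ 0 0
  have e01 :=
    momentMap_perm hσ hμ 0 1
  have e11 :=
    momentMap_perm hσ hμ 1 1
  rw [hp0, hp1] at e00 e01
  rw [hq0, hq1] at e01 e11
  have hp3 : M 0 (σ (.inr 0)) + M 0 (σ (.inl 2)) * M 0 (σ (.inr 2)) = 0 :=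
    eq_zero_of_add_self (by linear_combination e00)
  have hq4 : ι b * M 1 (σ (.inr 1)) + M 1 (σ (.inl 2)) * M 1 (σ (.inr 2)) = 0 :=
    eq_zero_of_add_self (by linear_combination e11)
  -- The values are the free entries of the section, with the second row divided by `b`.
  let ψ : MvPolynomial (Fin 6) ℂ →ₐ[ℂ] Localization.Away b :=
    aeval ![ι b, M 0 (σ (.inl 2)), M 0 (σ (.inr 2)), M 0 (σ (.inr 1)), b' * M 1 (σ (.inl 2)),
      b' * M 1 (σ (.inr 2))]
  have hψ : (chartMatrix.submatrix id σ.symm).map ψ = M := by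
    ext a k
    obtain ⟨s, rfl⟩ := σ.surjective k
    rw [Matrix.map_apply, Matrix.submatrix_apply, Equiv.symm_apply_apply, id_eq]
    fin_cases a <;> rcases s with s | s <;> fin_cases s <;>
      simp only [chartMatrix, ψ, Fin.zero_eta, Fin.mk_one, Fin.reduceFinMk, Matrix.of_apply,
        Matrix.cons_val, Sum.elim_inl, Sum.elim_inr, map_one, map_zero, map_neg, map_mul, map_add,
        aeval_X]
    · exact hp0.symm
    · exact hp1.symm
    · linear_combination -hp3
    · exact hq0.symm
    · exact hq1.symm
    · linear_combination M 1 (σ (.inl 2)) * hb'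
    · linear_combination -e01 - (M 0 (σ (.inl 2)) * M 1 (σ (.inr 2)) +
        M 0 (σ (.inr 2)) * M 1 (σ (.inl 2))) * hb'
    · linear_combination -b' * hq4 + (M 1 (σ (.inr 1)) -
        b' * M 1 (σ (.inl 2)) * M 1 (σ (.inr 2))) * hb'
    · linear_combination M 1 (σ (.inr 2)) * hb'
  have hcomp : ψ.comp θ = ι := by
    apply orbit_algHom_ext
    rw [AlgHom.coe_comp, ← Matrix.map_map, hθ, ← map_nuMap, hψ, hν]
  have hf0 : θ f = 0 := (hf.map θ).eq_zero
  have hι : algebraMap OrbitClosureRing (Localization.Away b) f = 0 := by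
    change ι f = 0
    rw [← hcomp, AlgHom.comp_apply, hf0, map_zero]
  obtain ⟨⟨_, n, rfl⟩, hn⟩ := (IsLocalization.map_eq_zero_iff (Submonoid.powers b) _ f).mp hι
  exact ⟨n, hn⟩

end Chart

/-! ### Reducedness and density of the open subscheme -/

theorem isReduced_localization_atPrime {R : Type*} [CommRing R] (p : Ideal R) [p.IsPrime] {b : R}
    (hb : b ∉ p) (h : ∀ f : R, IsNilpotent f → ∃ n : ℕ, b ^ n * f = 0) :
    _root_.IsReduced (Localization.AtPrime p) := by
  refine ⟨fun z ⟨n, hz⟩ => ?_⟩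
  obtain ⟨f, s, rfl⟩ := IsLocalization.exists_mk'_eq p.primeCompl z
  rw [← IsLocalization.mk'_pow, IsLocalization.mk'_eq_zero_iff] at hz
  obtain ⟨u, hu⟩ := hz
  -- The exponent is `n + 1` because for `n = 0` the power `(u f)ⁿ` would not contain the factor
  -- `u`.
  have hnil : IsNilpotent (u * f : R) := ⟨n + 1, by
    rw [mul_pow, pow_succ, pow_succ]
    linear_combination (u : R) ^ n * f * hu⟩
  obtain ⟨m, hm⟩ := h _ hnil
  rw [IsLocalization.mk'_eq_zero_iff]
  refine ⟨⟨b ^ m, ?_⟩ * u, ?_⟩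
  · rw [Submonoid.coe_mul, mul_assoc]
    exact hm
  · exact fun hmem => hb (Ideal.IsPrime.mem_of_pow_mem ‹_› m hmem)

/-- The open subscheme of the orbit closure on which some coordinate is nonzero. -/
def orbitOpen : orbitClosureScheme.Opens :=
  ⨆ p : Idx × Idx, PrimeSpectrum.basicOpen (coord orbitMatrix p.1 p.2)

theorem mem_orbitOpen (x : PrimeSpectrum OrbitClosureRing) :
    x ∈ (orbitOpen : TopologicalSpace.Opens (PrimeSpectrum OrbitClosureRing)) ↔
      ∃ i j, coord orbitMatrix i j ∉ x.asIdeal := by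
  refine (TopologicalSpace.Opens.mem_iSup (x := x)).trans ?_
  simp only [PrimeSpectrum.mem_basicOpen, Prod.exists]

theorem coord_evalAt (A : Matrix Idx Idx ℂ) (hA : A ∈ orbitClosure) (i j : Idx) :
    evalAt A hA (coord orbitMatrix i j) = coord A i j := by
  conv_rhs => rw [← orbitMatrix_map_evalAt A hA]
  rfl

theorem closedPoint_mem_orbitOpen (A : Matrix Idx Idx ℂ) (hA : A ∈ orbitClosure) :
    closedPoint A hA ∈ orbitOpen ↔ A ∈ nilpotentOrbit := by
  rw [mem_nilpotentOrbit_iff hA]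
  refine (mem_orbitOpen _).trans ?_
  have h : ∀ i j, coord orbitMatrix i j ∉ (PrimeSpectrum.comap (evalAt A hA).toRingHom ⊥).asIdeal ↔
      coord A i j ≠ 0 := fun i j => by
    rw [← coord_evalAt A hA]
    rfl
  refine ⟨?_, fun h0 => ?_⟩
  · rintro ⟨i, j, hij⟩ rfl
    exact (h i j).mp hij rfl
  · by_contra! hall
    exact h0 (ext_coord fun i j => not_not.mp fun hne => (h i j).mpr hne (hall i j))

/-- Such a `φ` factors through evaluation at the origin. Hence the origin is the only scheme point
outside `orbitOpen`. -/
theorem eq_zero_of_evalAt_zero {S : Type*} [CommRing S] [Algebra ℂ S]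
    (φ : OrbitClosureRing →ₐ[ℂ] S) (hφ : ∀ i j, φ (coord orbitMatrix i j) = 0)
    {f : OrbitClosureRing} (hf : evalAt 0 zero_mem_orbitClosure f = 0) : φ f = 0 := by
  have h : φ = (Algebra.ofId ℂ S).comp (evalAt 0 zero_mem_orbitClosure) := by
    apply orbit_algHom_ext
    refine ext_coord fun i j => ?_
    rw [AlgHom.coe_comp, ← Matrix.map_map, orbitMatrix_map_evalAt]
    exact (hφ i j).trans (map_zero (Algebra.ofId ℂ S)).symm
  rw [h, AlgHom.comp_apply, hf, map_zero]

open Polynomial in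
theorem dense_orbitOpen : Dense (orbitOpen : Set orbitClosureScheme) := by
  -- The curve `t ↦ t e₁ ∧ e₂`, which passes through the origin at `t = 0` and lies in the orbit
  -- elsewhere.
  let M : Matrix (Fin 2) Idx ℂ[X] :=
    Matrix.of ![Pi.single (Sum.inl 0) X, Pi.single (Sum.inl 1) 1]
  have hM : momentMap M = 0 := by
    rw [momentMap_eq_zero_iff]
    intro a b
    fin_cases a <;> fin_cases b <;> simp [M, Pi.single_apply]
  let θ : OrbitClosureRing →ₐ[ℂ] ℂ[X] := orbitLift (nuMap M) (closureEquations_nuMap M hM)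
  have hθ : orbitMatrix.map θ = nuMap M := orbitMatrix_map_lift _ _
  have hθ0 : (aeval (0 : ℂ)).comp θ = evalAt 0 zero_mem_orbitClosure := by
    apply orbit_algHom_ext
    rw [AlgHom.coe_comp, ← Matrix.map_map, hθ, orbitMatrix_map_evalAt, ← map_nuMap]
    ext k l
    rw [nuMap_apply]
    simp [M, Pi.single_apply, apply_ite]
  -- The generic point of the curve: it lies in the open set and specializes to the origin.
  let y : PrimeSpectrum OrbitClosureRing := PrimeSpectrum.comap θ.toRingHom ⊥
  have hy : ∀ f, f ∈ y.asIdeal ↔ θ f = 0 := fun f => Iff.rfl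
  have hyU : ∃ i j, coord orbitMatrix i j ∉ y.asIdeal := by
    refine ⟨.inl 0, .inl 1, ?_⟩
    rw [hy, ← coord_map θ, hθ, coord_nuMap]
    simp [M]
  have key : Dense {x : PrimeSpectrum OrbitClosureRing |
      ∃ i j, coord orbitMatrix i j ∉ x.asIdeal} := by
    intro x
    by_cases hx : ∃ i j, coord orbitMatrix i j ∉ x.asIdeal
    · exact subset_closure hx
    · rw [PrimeSpectrum.isTopologicalBasis_basic_opens.mem_closure_iff]
      rintro _ ⟨f, rfl⟩ hf
      refine ⟨y, fun hyf => hf ?_, hyU⟩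
      push Not at hx
      refine Ideal.Quotient.eq_zero_iff_mem.mp (eq_zero_of_evalAt_zero
        (S := OrbitClosureRing ⧸ x.asIdeal) (Ideal.Quotient.mkₐ ℂ x.asIdeal)
        (fun i j => Ideal.Quotient.eq_zero_iff_mem.mpr (hx i j)) ?_)
      rw [← hθ0, AlgHom.comp_apply, (hy f).mp hyf, map_zero]
  have hU : (orbitOpen : Set orbitClosureScheme) = {x : PrimeSpectrum OrbitClosureRing |
      ∃ i j, coord orbitMatrix i j ∉ x.asIdeal} := Set.ext mem_orbitOpen
  rw [hU]
  exact key

theorem isReduced_orbitOpen : AlgebraicGeometry.IsReduced orbitOpen.toScheme := by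
  have hstalk : ∀ x : orbitOpen.toScheme,
      _root_.IsReduced (orbitOpen.toScheme.presheaf.stalk x) := by
    intro x
    let q : PrimeSpectrum OrbitClosureRing := x.1
    obtain ⟨i, j, h₁, h₂, hij⟩ := exists_isotropic_coord_notMem closureEquations_orbitMatrix
      q.asIdeal ((mem_orbitOpen q).mp x.2)
    have hred := isReduced_localization_atPrime q.asIdeal hij
      fun f hf => exists_pow_mul_eq_zero_of_isNilpotent h₁ h₂ hf
    have hred' : _root_.IsReduced (orbitClosureScheme.presheaf.stalk x.1) :=
      isReduced_of_injective
        (Spec.stalkIso (CommRingCat.of OrbitClosureRing) x.1).hom.hom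
        (Spec.stalkIso (CommRingCat.of OrbitClosureRing) x.1).commRingCatIsoToRingEquiv.injective
    exact isReduced_of_injective (orbitOpen.stalkIso x).hom.hom
      (orbitOpen.stalkIso x).commRingCatIsoToRingEquiv.injective
  exact isReduced_of_isReduced_stalk _

theorem flat_nu_orbitOpen : Flat (nu ∣_ orbitOpen) := by
  refine flat_morphismRestrict_of_basicOpen (CommRingCat.ofHom nuComorphism.toRingHom) orbitOpen
    fun x hx => ?_
  obtain ⟨i, j, hij⟩ := (mem_orbitOpen x).mp hx
  refine ⟨coord orbitMatrix i j, hij, ?_, flat_awayMap i j⟩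
  exact le_iSup (fun p : Idx × Idx => PrimeSpectrum.basicOpen (coord orbitMatrix p.1 p.2)) (i, j)

/-! ### Functions on `SL₂` and the Hilbert function -/

section HilbertFunction

open MvPolynomial

/-- Evaluation of functions on `SL₂` at a complex point. -/
def sl2Eval (h : SL(2, ℂ)) : SL2Ring →ₐ[ℂ] ℂ := sl2Lift h.1 h.2

theorem sl2Matrix_map_eval (h : SL(2, ℂ)) : sl2Matrix.map (sl2Eval h) = h.1 :=
  sl2Matrix_map_lift h.1 h.2

theorem sl2Eval_apply (h : SL(2, ℂ)) (i j : Fin 2) : sl2Eval h (sl2Matrix i j) = h.1 i j :=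
  congrFun (congrFun (sl2Matrix_map_eval h) i) j

theorem sl2Eval_action (g h : SL(2, ℂ)) (f : SL2Ring) :
    sl2Eval h (sl2Action g f) = sl2Eval (g⁻¹ * h) f := by
  have e : (sl2Eval h).comp (sl2Action g) = sl2Eval (g⁻¹ * h) := by
    apply sl2_algHom_ext
    rw [AlgHom.coe_comp, ← Matrix.map_map, sl2Matrix_map_action, map_matrix_mul,
      sl2Matrix_map_eval, sl2Matrix_map_eval, Matrix.SpecialLinearGroup.coe_mul]
    congr 1
    ext i j
    exact (sl2Eval h).commutes _
  exact DFunLike.congr_fun e f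

theorem sl2Matrix_det_eq :
    sl2Matrix 0 0 * sl2Matrix 1 1 - sl2Matrix 0 1 * sl2Matrix 1 0 = 1 := by
  rw [← Matrix.det_fin_two, det_sl2Matrix]

/-- Up to a power of `a`, a function on `SL₂` is a polynomial in the matrix entries `a, b, c`. -/
theorem exists_pow_mul_eq_aeval (f : SL2Ring) : ∃ (n : ℕ) (p : MvPolynomial (Fin 3) ℂ),
    sl2Matrix 0 0 ^ n * f = aeval ![sl2Matrix 0 0, sl2Matrix 0 1, sl2Matrix 1 0] p := by
  obtain ⟨f, rfl⟩ := Ideal.Quotient.mk_surjective f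
  induction f using MvPolynomial.induction_on with
  | C z =>
    refine ⟨0, C z, ?_⟩
    rw [pow_zero, one_mul, MvPolynomial.aeval_C]
    rfl
  | add f g hf hg =>
    obtain ⟨n, p, hp⟩ := hf
    obtain ⟨m, q, hq⟩ := hg
    refine ⟨n + m, X 0 ^ m * p + X 0 ^ n * q, ?_⟩
    rw [map_add, map_add, map_mul, map_mul, ← hp, ← hq, map_pow, map_pow, aeval_X]
    simp only [Matrix.cons_val_zero]
    ring
  | mul_X f x hf =>
    obtain ⟨n, p, hp⟩ := hf
    obtain ⟨m, q, hq⟩ : ∃ (m : ℕ) (q : MvPolynomial (Fin 3) ℂ),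
        sl2Matrix 0 0 ^ m * sl2Matrix x.1 x.2 =
          aeval ![sl2Matrix 0 0, sl2Matrix 0 1, sl2Matrix 1 0] q := by
      obtain ⟨i, j⟩ := x
      fin_cases i <;> fin_cases j
      · exact ⟨0, X 0, by simp⟩
      · exact ⟨0, X 1, by simp⟩
      · exact ⟨0, X 2, by simp⟩
      · refine ⟨1, 1 + X 1 * X 2, ?_⟩
        simp only [Fin.mk_one, map_add, map_mul, map_one, aeval_X, Matrix.cons_val]
        linear_combination sl2Matrix_det_eq
    refine ⟨n + m, p * q, ?_⟩
    rw [map_mul, map_mul, ← hp, ← hq, pow_add]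
    change _ * (_ * sl2Matrix x.1 x.2) = _
    ring

/-- Where `a ≠ 0`, the entries `a, b, c` are free coordinates on `SL₂` and `d = (1 + bc)/a`. This
reduces the claim to polynomials on `ℂ³`. -/
theorem exists_pow_mul_eq_zero_of_sl2Eval {f : SL2Ring} (hf : ∀ h, sl2Eval h f = 0) :
    ∃ n : ℕ, sl2Matrix 0 0 ^ n * f = 0 := by
  obtain ⟨n, p, hp⟩ := exists_pow_mul_eq_aeval f
  refine ⟨n, ?_⟩
  -- The vanishing of `p` is known only where `a ≠ 0`; the factor `X 0` covers the rest of `ℂ³`.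
  suffices hX : X 0 * p = 0 by
    rw [hp, (mul_eq_zero.mp hX).resolve_left (X_ne_zero 0), map_zero]
  refine MvPolynomial.funext fun v => ?_
  rw [map_mul, eval_X, map_zero, mul_eq_zero]
  by_cases hv : v 0 = 0
  · exact Or.inl hv
  · right
    let h : SL(2, ℂ) := ⟨!![v 0, v 1; v 2, (1 + v 1 * v 2) / v 0], by
      rw [Matrix.det_fin_two_of]
      field_simp
      ring⟩
    have h1 := congrArg (sl2Eval h) hp
    rw [map_mul, hf, mul_zero, comp_aeval_apply] at h1
    have h2 : (fun i => sl2Eval h (![sl2Matrix 0 0, sl2Matrix 0 1, sl2Matrix 1 0] i)) = v := by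
      funext i
      fin_cases i
      · exact sl2Eval_apply h 0 0
      · exact sl2Eval_apply h 0 1
      · exact sl2Eval_apply h 1 0
    rw [h2] at h1
    exact h1.symm

/-- A regular function on `SL₂` that vanishes at all complex points is zero. -/
theorem sl2_eq_zero_of_eval {f : SL2Ring} (hf : ∀ h, sl2Eval h f = 0) : f = 0 := by
  obtain ⟨n, hn⟩ := exists_pow_mul_eq_zero_of_sl2Eval hf
  -- Translation by this element turns `a` into `c`. Then `f` is killed by a power of `a` and by a
  -- power of `c`, which are coprime since `ad - bc = 1`.
  let g : SL(2, ℂ) := ⟨!![0, 1; -1, 0], by simp [Matrix.det_fin_two_of]⟩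
  obtain ⟨m, hm⟩ := exists_pow_mul_eq_zero_of_sl2Eval (f := sl2Action g f)
    fun h => by rw [sl2Eval_action, hf]
  have hm' := congrArg (sl2Action g⁻¹) hm
  have hg : sl2Action g⁻¹ (sl2Action g f) = f := by
    rw [← AlgHom.mul_apply, ← map_mul, inv_mul_cancel, map_one, AlgHom.one_apply]
  have ha : sl2Action g⁻¹ (sl2Matrix 0 0) = sl2Matrix 1 0 := by
    have h := congrFun (congrFun (sl2Matrix_map_action g⁻¹) 0) 0
    rw [Matrix.map_apply] at h
    rw [h, Matrix.mul_apply, Fin.sum_univ_two, inv_inv]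
    simp [g]
  rw [map_mul, map_pow, hg, ha, map_zero] at hm'
  have hcop : IsCoprime (sl2Matrix 0 0) (sl2Matrix 1 0) :=
    ⟨sl2Matrix 1 1, -sl2Matrix 0 1, by linear_combination sl2Matrix_det_eq⟩
  obtain ⟨u, v, huv⟩ := hcop.pow (m := n) (n := m)
  linear_combination u * hn + v * hm' - f * huv

theorem sl2_ext {f f' : SL2Ring} (h : ∀ g, sl2Eval g f = sl2Eval g f') : f = f' := by
  rw [← sub_eq_zero]
  exact sl2_eq_zero_of_eval fun g => by rw [map_sub, h, sub_self]

/-! ### Matrix coefficients and Frobenius reciprocity -/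

/-- The matrix coefficient map `f ↦ (X ↦ f(X y))`. -/
def coaction : MvPolynomial (Fin 2 × Unit) ℂ →ₐ[ℂ] MvPolynomial (Fin 2 × Unit) SL2Ring :=
  aeval fun p => ∑ k, C (sl2Matrix p.1 k) * X (k, p.2)

/-- The action is `(g f)(y) = f(g⁻¹ y)`, so specializing `X` to `h` in `f(X y)` gives the action of
`h⁻¹`. -/
theorem map_sl2Eval_coaction (h : SL(2, ℂ)) (f : MvPolynomial (Fin 2 × Unit) ℂ) :
    MvPolynomial.map (sl2Eval h : SL2Ring →+* ℂ) (coaction f) = polyAction Unit h⁻¹ f := by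
  have e : (mapAlgHom (sl2Eval h)).comp coaction = polyAction Unit h⁻¹ := by
    ext p : 1
    rw [AlgHom.comp_apply, coaction, aeval_X, map_sum]
    simp only [polyAction, MonoidHom.coe_mk, OneHom.coe_mk, aeval_X, translated, inv_inv]
    simp [Matrix.mul_apply, scalarMatrix, genM, sl2Eval_apply]
  exact DFunLike.congr_fun e f

/-- The extension of a linear form on polynomials to polynomials with coefficients in `ℂ[SL₂]`. -/
def extendForm (l : MvPolynomial (Fin 2 × Unit) ℂ →ₗ[ℂ] ℂ) :
    MvPolynomial (Fin 2 × Unit) SL2Ring →ₗ[SL2Ring] SL2Ring :=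
  (basisMonomials (Fin 2 × Unit) SL2Ring).constr SL2Ring
    fun m => scalarMap SL2Ring (l (monomial m 1))

theorem sl2Eval_extendForm (l : MvPolynomial (Fin 2 × Unit) ℂ →ₗ[ℂ] ℂ) (h : SL(2, ℂ))
    (F : MvPolynomial (Fin 2 × Unit) SL2Ring) :
    sl2Eval h (extendForm l F) = l (MvPolynomial.map (sl2Eval h : SL2Ring →+* ℂ) F) := by
  induction F using MvPolynomial.induction_on' with
  | add F G hF hG => rw [map_add, map_add, map_add, map_add, hF, hG]
  | monomial m s =>
    have h1 : monomial m s = s • basisMonomials (Fin 2 × Unit) SL2Ring m := by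
      rw [coe_basisMonomials, smul_monomial, smul_eq_mul, mul_one]
    have h2 : (monomial m (sl2Eval h s) : MvPolynomial (Fin 2 × Unit) ℂ) =
        sl2Eval h s • monomial m 1 := by
      rw [smul_monomial, smul_eq_mul, mul_one]
    rw [map_monomial]
    change _ = l (monomial m (sl2Eval h s))
    rw [h2, map_smul, h1, map_smul, extendForm, Module.Basis.constr_basis, smul_eq_mul, map_mul,
      smul_eq_mul]
    congr 1
    exact (sl2Eval h).commutes _

/-- A linear form on binary forms of degree `d` is the evaluation at `1` of an equivariant map to
`ℂ[SL₂]`. -/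
theorem exists_matrixCoefficient (d : ℕ) (l : Module.Dual ℂ (BinaryForms d)) :
    ∃ φ : BinaryForms d →ₗ[ℂ] SL2Ring,
      ∀ (h : SL(2, ℂ)) (v : BinaryForms d), sl2Eval h (φ v) = l (binaryFormsRep d h⁻¹ v) := by
  obtain ⟨l', hl'⟩ := LinearMap.exists_extend l
  -- The function `h ↦ l(h⁻¹ v)` is regular: apply `l'` coefficientwise to `v(X y)`.
  refine ⟨(extendForm l').restrictScalars ℂ ∘ₗ coaction.toLinearMap ∘ₗ
    (BinaryForms d).subtype, fun h v => ?_⟩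
  change sl2Eval h (extendForm l' (coaction v)) = _
  rw [sl2Eval_extendForm, map_sl2Eval_coaction, ← hl']
  rfl

/-- The basis consists of the monomials `x^k y^(d-k)` with `0 ≤ k ≤ d`. -/
theorem rank_binaryForms (d : ℕ) : Module.rank ℂ (BinaryForms d) = (d : Cardinal) + 1 := by
  have hdeg : ∀ m : Fin 2 × Unit →₀ ℕ, m.degree = m (0, ()) + m (1, ()) := fun m => by
    rw [Finsupp.degree_eq_sum, Fintype.sum_prod_type, Fin.sum_univ_two, Fintype.sum_unique,
      Fintype.sum_unique]
  let e : {m : Fin 2 × Unit →₀ ℕ | m.degree = d} ≃ Fin (d + 1) :=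
    { toFun := fun m => ⟨m.1 (0, ()), by
        have h : m.1.degree = d := m.2
        rw [hdeg] at h
        omega⟩
      invFun := fun k => ⟨Finsupp.single (0, ()) k.1 + Finsupp.single (1, ()) (d - k.1), by
        rw [Set.mem_ofPred_eq, hdeg]
        simp
        omega⟩
      left_inv := fun m => by
        have h : m.1.degree = d := m.2
        rw [hdeg] at h
        ext ⟨i, u⟩
        fin_cases i
        · simp
        · have h' : d - m.1 (0, ()) = m.1 (1, ()) := by omega
          simpa using h'
      right_inv := fun k => by
        ext
        simp }
  have hb : BinaryForms d = restrictSupport ℂ {m : Fin 2 × Unit →₀ ℕ | m.degree = d} :=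
    homogeneousSubmodule_eq_finsupp_supported _ _ d
  rw [hb, ← (basisRestrictSupport ℂ {m : Fin 2 × Unit →₀ ℕ | m.degree = d}).mk_eq_rank'',
    Cardinal.mk_congr e, Cardinal.mk_fin]
  push_cast
  rfl

instance finite_binaryForms (d : ℕ) : Module.Finite ℂ (BinaryForms d) :=
  Module.Finite.iff_fg.mpr (homogeneousSubmodule_fg _ _ d)

/-- Once the fibre is identified with `SL₂`, an equivariant map is determined by its values at `1`,
and any linear form on `V_d` can be prescribed there. The multiplicity is thus the dimension of the
dual of `V_d`. -/
theorem multiplicity_eq {A : Matrix Idx Idx ℂ} (hA : A ∈ orbitClosure) (h0 : A ≠ 0) (d : ℕ) :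
    multiplicity A hA d = (d : Cardinal) + 1 := by
  obtain ⟨e, he⟩ := exists_fibre_equiv hA h0
  let ev : (binaryFormsRep d).IntertwiningMap (fibreRep A hA) →ₗ[ℂ]
      Module.Dual ℂ (BinaryForms d) :=
    { toFun := fun φ => (sl2Eval 1).toLinearMap ∘ₗ e.toLinearMap ∘ₗ φ.toLinearMap
      map_add' := fun φ ψ => by
        ext v
        change sl2Eval 1 (e (φ v + ψ v)) = sl2Eval 1 (e (φ v)) + sl2Eval 1 (e (ψ v))
        rw [map_add, map_add]
      map_smul' := fun c φ => by
        ext v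
        change sl2Eval 1 (e (c • φ v)) = c • sl2Eval 1 (e (φ v))
        rw [map_smul, map_smul] }
  have hev : ∀ φ v, ev φ v = sl2Eval 1 (e (φ v)) := fun φ v => rfl
  have hinj : Function.Injective ev := by
    rw [injective_iff_map_eq_zero]
    intro φ hφ
    refine DFunLike.ext _ _ fun v => ?_
    apply e.injective
    refine Eq.trans (sl2_eq_zero_of_eval fun h => ?_) (map_zero e).symm
    -- Equivariance moves the value of the image of `v` at `h` to the value of the image of `h⁻¹ v`
    -- at `1`.
    have h1 : φ (binaryFormsRep d h⁻¹ v) = fibreAction A hA h⁻¹ (φ v) :=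
      φ.isIntertwining _ _ h⁻¹ v
    have h2 := hev φ (binaryFormsRep d h⁻¹ v)
    rw [hφ, h1, he, sl2Eval_action, inv_inv, mul_one] at h2
    exact h2.symm
  have hsurj : Function.Surjective ev := by
    intro l
    obtain ⟨φ, hφ⟩ := exists_matrixCoefficient d l
    refine ⟨⟨e.symm.toLinearMap ∘ₗ φ, fun g => ?_⟩, ?_⟩
    · ext v
      apply e.injective
      change e (e.symm (φ (binaryFormsRep d g v))) = e (fibreAction A hA g (e.symm (φ v)))
      rw [he, AlgEquiv.apply_symm_apply, AlgEquiv.apply_symm_apply]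
      -- Equivariance may be tested at complex points, where both sides become `l(h⁻¹ g v)`.
      refine sl2_ext fun h => ?_
      rw [hφ, sl2Eval_action, hφ, mul_inv_rev, inv_inv, map_mul]
      rfl
    · ext v
      change sl2Eval 1 (e (e.symm (φ v))) = l v
      rw [AlgEquiv.apply_symm_apply, hφ, inv_one, map_one]
      rfl
  rw [multiplicity, (LinearEquiv.ofBijective ev ⟨hinj, hsurj⟩).rank_eq, Module.dual_rank_eq,
    Cardinal.lift_id, rank_binaryForms]

end HilbertFunction

end SymplecticReduction

end

theorem mainTheorem8 :
    -- the orbit closure consists of the orbit and zero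
    SymplecticReduction.orbitClosure = SymplecticReduction.nilpotentOrbit ∪ {0} ∧
    -- the orbit is (the set of closed points of) a dense open reduced subscheme `U`
    ∃ U : SymplecticReduction.orbitClosureScheme.Opens,
      (∀ (A : Matrix SymplecticReduction.Idx SymplecticReduction.Idx ℂ)
        (hA : A ∈ SymplecticReduction.orbitClosure),
        SymplecticReduction.closedPoint A hA ∈ U ↔ A ∈ SymplecticReduction.nilpotentOrbit) ∧
      Dense (U : Set SymplecticReduction.orbitClosureScheme) ∧
      AlgebraicGeometry.IsReduced U.toScheme ∧
      -- the restriction of `ν` over the orbit is flat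
      AlgebraicGeometry.Flat (SymplecticReduction.nu ∣_ U) ∧
      -- the fibres over the orbit are isomorphic to each other
      (∀ (A B : Matrix SymplecticReduction.Idx SymplecticReduction.Idx ℂ)
        (hA : A ∈ SymplecticReduction.orbitClosure) (hB : B ∈ SymplecticReduction.orbitClosure),
        A ∈ SymplecticReduction.nilpotentOrbit → B ∈ SymplecticReduction.nilpotentOrbit →
        Nonempty (SymplecticReduction.FibreRing A hA ≃ₐ[ℂ]
          SymplecticReduction.FibreRing B hB)) ∧
      -- they are isomorphic to `SL₂`, equivariantly, and have Hilbert function `d ↦ d + 1`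
      (∀ (A : Matrix SymplecticReduction.Idx SymplecticReduction.Idx ℂ)
        (hA : A ∈ SymplecticReduction.orbitClosure),
        A ∈ SymplecticReduction.nilpotentOrbit →
        (∃ e : SymplecticReduction.FibreRing A hA ≃ₐ[ℂ] SymplecticReduction.SL2Ring,
          ∀ (g : Matrix.SpecialLinearGroup (Fin 2) ℂ) (f : SymplecticReduction.FibreRing A hA),
            e (SymplecticReduction.fibreAction A hA g f) =
              SymplecticReduction.sl2Action g (e f)) ∧
        ∀ d : ℕ, SymplecticReduction.multiplicity A hA d = (d : Cardinal) + 1) := by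
  refine ⟨SymplecticReduction.orbitClosure_eq, SymplecticReduction.orbitOpen,
    SymplecticReduction.closedPoint_mem_orbitOpen, SymplecticReduction.dense_orbitOpen,
    SymplecticReduction.isReduced_orbitOpen, SymplecticReduction.flat_nu_orbitOpen, ?_, ?_⟩
  · intro A B hA hB hA' hB'
    obtain ⟨e, -⟩ := SymplecticReduction.exists_fibre_equiv hA
      ((SymplecticReduction.mem_nilpotentOrbit_iff hA).mp hA')
    obtain ⟨e', -⟩ := SymplecticReduction.exists_fibre_equiv hB
      ((SymplecticReduction.mem_nilpotentOrbit_iff hB).mp hB')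
    exact ⟨e.trans e'.symm⟩
  · intro A hA hA'
    have h0 := (SymplecticReduction.mem_nilpotentOrbit_iff hA).mp hA'
    exact ⟨SymplecticReduction.exists_fibre_equiv hA h0,
      SymplecticReduction.multiplicity_eq hA h0⟩
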